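/- Let $T>0$, $n,m,r\in\mathbb N$, $B\in\mathbb R^{n\times m}$, $C\in\mathbb R^{r\times n}$, $x_0\in\mathbb R^n$, and for $k=1,\dots,N$ ($N\ge 1$) let $A_k\in\mathbb R^{n\times n}$ and let $\Gamma_k\in\mathbb R^{n\times n}$, $R_k\in\mathbb R^{m\times m}$, $Q_k\in\mathbb R^{r\times r}$ be symmetric positive definite. Write $\|x\|_S^2=x^\top S x$. Let $\Pi_k$ be the solution on $[0,T]$ of $$\dot\Pi_k=A_k\Pi_k+\Pi_kA_k^\top-\Pi_kC^\top Q_k^{-1}C\Pi_k+BR_kB^\top,\qquad \Pi_k(0)=\Gamma_k,$$ and $P_k=\Pi_k^{-1}$. For an output $y\in L^2(0,T;\mathbb R^r)$ let $\widehat x_k$ be the (absolutely continuous) solution on $[0,T]$ of $$\dot{\widehat x}_k=A_k\widehat x_k+\Pi_kC^\top Q_k^{-1}(y-C\widehat x_k),\qquad \widehat x_k(0)=x_0,$$ and put $$\mathcal V_k(t,x)=\|x-\widehat x_k(t)\|_{P_k(t)}^2+\int_0^t\|y(s)-C\widehat x_k(s)\|_{Q_k^{-1}}^2\,\mathrm ds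 .$$ For $\theta\in(0,\infty)$ and $t\in[0,T]$ let $\widehat x_\theta(t)$ be the unique minimizer over $x\in\mathbb R^n$ of the entropic risk $\frac1\theta\ln\bigl(\frac1N\sum_{k=1}^N e^{\theta\mathcal V_k(t,x)}\bigr)$. Then: 1. If $y\in L^{2p}(0,T;\mathbb R^r)$ with an integer $1\le p<\infty$, then $\widehat x_\theta\in W^{1,p}(0,T;\mathbb R^n)$. 2. If $y\in C([0,T];\mathbb R^r)$, then $\widehat x_\theta\in C^1([0,T];\mathbb R^n)$. In both settings $M(t,\widehat x_\theta(t))$ is invertible for every $t\in[0,T]$ and the derivative (the weak derivative in 1., the classical one at every $t\in[0,T]$, one-sided at the end points, in 2.) is $$\dot{\widehat x}_\theta(t)=-M(t,\widehat x_\theta(t))^{-1}\,V(t,\widehat x_\theta(t)),$$ where $$M(t,x)=\sum_{k=1}^N e^{\theta\mathcal V_k(t,x)}\Bigl(P_k(t)+2\theta\,P_k(t)(x-\widehat x_k(t))(x-\widehat x_k(t))^\top P_k(t)\Bigr)$$ and $$\begin{aligned}V(t,x)=&-\sum_{k=1}^N e^{\theta\mathcal V_k(t,x)}\Bigl(P_k(t)\dot{\widehat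 x}_k(t)-\dot P_k(t)(x-\widehat x_k(t))\Bigr)\\&+\theta\sum_{k=1}^N e^{\theta\mathcal V_k(t,x)}\Bigl(\|y(t)-C\widehat x_k(t)\|_{Q_k^{-1}}^2-2\langle x-\widehat x_k(t),P_k(t)\dot{\widehat x}_k(t)\rangle+\langle x-\widehat x_k(t),\dot P_k(t)(x-\widehat x_k(t))\rangle\Bigr)P_k(t)(x-\widehat x_k(t)).\end{aligned}$$ -/

import Mathlib

open MeasureTheory Set Matrix
open scoped ContDiff ENNReal

/-- A finite family, indexed by `ι`, of linear systems on a horizon `[0, T]`: common input and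
output matrices `B`, `C` and initial guess `x₀`, uncertain system matrices `A k` and uncertain
symmetric positive definite covariances `Γ k`, `R k`, `Q k`. -/
structure UncertainSystem (ι : Type*) (n m r : ℕ) where
  T : ℝ
  T_pos : 0 < T
  A : ι → Matrix (Fin n) (Fin n) ℝ
  B : Matrix (Fin n) (Fin m) ℝ
  C : Matrix (Fin r) (Fin n) ℝ
  Γ : ι → Matrix (Fin n) (Fin n) ℝ
  R : ι → Matrix (Fin m) (Fin m) ℝ
  Q : ι → Matrix (Fin r) (Fin r) ℝ
  x₀ : Fin n → ℝ
  Γ_posDef : ∀ k, (Γ k).PosDef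
  R_posDef : ∀ k, (R k).PosDef
  Q_posDef : ∀ k, (Q k).PosDef

/-- The squared weighted norm `‖x‖²_M = xᵀ M x`. -/
def wnormSq {d : ℕ} (M : Matrix (Fin d) (Fin d) ℝ) (x : Fin d → ℝ) : ℝ := x ⬝ᵥ (M *ᵥ x)

/-- The entropic risk `θ⁻¹ ln (𝔼 [exp (θ X)])` of a random variable on a finite set that carries
the uniform distribution. -/
noncomputable def entropicRisk {ι : Type*} [Fintype ι] (θ : ℝ) (X : ι → ℝ) : ℝ :=
  (1 / θ) * Real.log ((1 / (Fintype.card ι : ℝ)) * ∑ k, Real.exp (θ * X k))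

namespace UncertainSystem

variable {ι : Type*} {n m r : ℕ} (S : UncertainSystem ι n m r)

/-- `Pi` solves, on `[0, T]`, the differential Riccati equation
`Π' = A Π + Π Aᵀ - Π Cᵀ Q⁻¹ C Π + B R Bᵀ`, `Π(0) = Γ` of the `k`-th system (derivatives are taken
entrywise, one-sided at the end points). -/
def IsRiccatiSolution (k : ι) (Pi : ℝ → Matrix (Fin n) (Fin n) ℝ) : Prop :=
  Pi 0 = S.Γ k ∧ ∀ t ∈ Icc 0 S.T, ∀ i j,
    HasDerivWithinAt (fun s => Pi s i j)
      ((S.A k * Pi t + Pi t * (S.A k)ᵀ - Pi t * S.Cᵀ * (S.Q k)⁻¹ * S.C * Pi t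
        + S.B * S.R k * S.Bᵀ) i j) (Icc 0 S.T) t

/-- The covariance `Π_k`: the solution of the Riccati equation (relevant on `[0, T]` only). -/
noncomputable def covariance (k : ι) : ℝ → Matrix (Fin n) (Fin n) ℝ :=
  Classical.epsilon (S.IsRiccatiSolution k)

/-- The precision matrix `P_k = Π_k⁻¹`. -/
noncomputable def precision (k : ι) (t : ℝ) : Matrix (Fin n) (Fin n) ℝ := (S.covariance k t)⁻¹

/-- The time derivative of `P_k` (one-sided at the end points of `[0, T]`). -/
noncomputable def precisionDeriv (k : ι) (t : ℝ) : Matrix (Fin n) (Fin n) ℝ :=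
  Matrix.of fun i j => derivWithin (fun s => S.precision k s i j) (Icc 0 S.T) t

/-- `x` solves, on `[0, T]`, the Kalman filter equation
`x' = A x + Π Cᵀ Q⁻¹ (y - C x)`, `x(0) = x₀` of the `k`-th system for the output `y`, in the
sense of Carathéodory (`y` need not be continuous). -/
def IsKalmanFilter (y : ℝ → Fin r → ℝ) (k : ι) (x : ℝ → Fin n → ℝ) : Prop :=
  ContinuousOn x (Icc 0 S.T) ∧ ∀ t ∈ Icc 0 S.T,
    x t = S.x₀ + ∫ s in (0 : ℝ)..t,
      (S.A k *ᵥ x s + (S.covariance k s * S.Cᵀ * (S.Q k)⁻¹) *ᵥ (y s - S.C *ᵥ x s))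

/-- The Kalman filter trajectory of the `k`-th system for the output `y`
(relevant on `[0, T]` only). -/
noncomputable def kalman (y : ℝ → Fin r → ℝ) (k : ι) : ℝ → Fin n → ℝ :=
  Classical.epsilon (S.IsKalmanFilter y k)

/-- The time derivative of the Kalman filter trajectory. The trajectory is absolutely continuous,
so this function represents its weak derivative. -/
noncomputable def kalmanDeriv (y : ℝ → Fin r → ℝ) (k : ι) (t : ℝ) : Fin n → ℝ :=
  derivWithin (S.kalman y k) (Icc 0 S.T) t

/-- The accumulated residual `r_k(t) = ∫₀ᵗ ‖y - C x̂_k‖²_{Q_k⁻¹}`. -/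
noncomputable def residual (y : ℝ → Fin r → ℝ) (k : ι) (t : ℝ) : ℝ :=
  ∫ s in (0 : ℝ)..t, wnormSq (S.Q k)⁻¹ (y s - S.C *ᵥ S.kalman y k s)

/-- The energy (value function) `𝒱_k(t, x) = ‖x - x̂_k(t)‖²_{P_k(t)} + r_k(t)`. -/
noncomputable def energy (y : ℝ → Fin r → ℝ) (k : ι) (t : ℝ) (x : Fin n → ℝ) : ℝ :=
  wnormSq (S.precision k t) (x - S.kalman y k t) + S.residual y k t

variable [Fintype ι]

/-- The estimator `x̂_θ(t)`: the minimizer over `x ∈ ℝⁿ` of the entropic risk of the energy. -/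
noncomputable def estimator (θ : ℝ) (y : ℝ → Fin r → ℝ) (t : ℝ) : Fin n → ℝ :=
  Classical.epsilon fun x : Fin n → ℝ =>
    IsMinOn (fun z => entropicRisk θ fun k => S.energy y k t z) univ x

/-- `M(t, x) = ∑ₖ exp(θ 𝒱ₖ) (Pₖ + 2 θ Pₖ (x - x̂ₖ) ⊗ (x - x̂ₖ) Pₖ)`. -/
noncomputable def matM (θ : ℝ) (y : ℝ → Fin r → ℝ) (t : ℝ) (x : Fin n → ℝ) :
    Matrix (Fin n) (Fin n) ℝ :=
  ∑ k, Real.exp (θ * S.energy y k t x) •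
    (S.precision k t + (2 * θ) • (S.precision k t *
      vecMulVec (x - S.kalman y k t) (x - S.kalman y k t) * S.precision k t))

/-- `V(t, x) = - ∑ₖ exp(θ 𝒱ₖ) (Pₖ x̂ₖ' - Pₖ' (x - x̂ₖ))
  + θ ∑ₖ exp(θ 𝒱ₖ) (‖y - C x̂ₖ‖²_{Qₖ⁻¹} - 2 ⟨x - x̂ₖ, Pₖ x̂ₖ'⟩ + ⟨x - x̂ₖ, Pₖ' (x - x̂ₖ)⟩)
      Pₖ (x - x̂ₖ)`. -/
noncomputable def vecV (θ : ℝ) (y : ℝ → Fin r → ℝ) (t : ℝ) (x : Fin n → ℝ) : Fin n → ℝ :=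
  - ∑ k, Real.exp (θ * S.energy y k t x) •
      (S.precision k t *ᵥ S.kalmanDeriv y k t
        - S.precisionDeriv k t *ᵥ (x - S.kalman y k t))
  + θ • ∑ k, (Real.exp (θ * S.energy y k t x) *
      (wnormSq (S.Q k)⁻¹ (y t - S.C *ᵥ S.kalman y k t)
        - 2 * ((x - S.kalman y k t) ⬝ᵥ (S.precision k t *ᵥ S.kalmanDeriv y k t))
        + (x - S.kalman y k t) ⬝ᵥ (S.precisionDeriv k t *ᵥ (x - S.kalman y k t)))) •
      (S.precision k t *ᵥ (x - S.kalman y k t))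

/-- `- M(t, x̂_θ(t))⁻¹ V(t, x̂_θ(t))`. -/
noncomputable def estimatorDeriv (θ : ℝ) (y : ℝ → Fin r → ℝ) (t : ℝ) : Fin n → ℝ :=
  -((S.matM θ y t (S.estimator θ y t))⁻¹ *ᵥ S.vecV θ y t (S.estimator θ y t))

end UncertainSystem

/-- `g` is a weak derivative of `u` on the interval `(0, T)`. -/
def HasWeakDeriv {d : ℕ} (T : ℝ) (u g : ℝ → Fin d → ℝ) : Prop :=
  LocallyIntegrableOn u (Ioo 0 T) ∧ LocallyIntegrableOn g (Ioo 0 T) ∧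
    ∀ φ : ℝ → ℝ, ContDiff ℝ ∞ φ → HasCompactSupport φ → tsupport φ ⊆ Ioo 0 T →
      ∫ t in Ioo 0 T, deriv φ t • u t = -∫ t in Ioo 0 T, φ t • g t

/-- `u ∈ W^{1,p}(0, T; ℝᵈ)`. -/
def MemW1p {d : ℕ} (T : ℝ) (p : ℝ≥0∞) (u : ℝ → Fin d → ℝ) : Prop :=
  MemLp u p (volume.restrict (Ioo 0 T)) ∧
    ∃ g : ℝ → Fin d → ℝ, MemLp g p (volume.restrict (Ioo 0 T)) ∧ HasWeakDeriv T u g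

/-! The energies at time `t` depend on finitely many parameters, `params` `= (P_k, x̂_k, r_k)_k`.
Since the logarithm is increasing, the estimator minimizes the sum of the weights `exp (θ 𝒱_k)`, and
therefore is a zero of `grad`, the gradient of that sum up to the factor `2θ`. `grad` is strictly
monotone in `x` (`grad_strictMono`), so the zero is unique, and its `x`-derivative `hess` (the
matrix `M`) is invertible (`hess_isUnit`). The implicit function theorem (`exists_local_solution`)
then writes the estimator locally as `ψ ∘ params`, with `ψ` locally Lipschitz and differentiable at
the base point. Differentiating `grad = 0` along the trajectory gives `M x' + V = 0`.

Thus the estimator is as regular as `params`. For continuous `y` the parameters are `C¹`. For `y ∈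
L^{2p}` they are absolutely continuous with derivative in `L^p`, the residual density being
quadratic in `y`; the Lipschitz bound on increments passes both properties to the estimator.

`covariance`, `kalman` and `estimator` are chosen by `Classical.epsilon`, so solutions and
minimizers must be shown to exist. The Riccati equation is solved by `Π = Y X⁻¹` with `(X, Y)` a
linear Hamiltonian flow, where positivity of `XᵀY` keeps `X` invertible; the same `X` yields a
fundamental matrix for the Kalman filter. Coercivity gives the minimizer. -/

section MatrixCalculus

/-! ### Matrix derivatives and the linear Hamiltonian system. -/

open scoped Matrix.Norms.Operator

variable {n : ℕ}

/-- The entry `(i, j)` as a continuous linear functional on matrices. -/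
noncomputable def Matrix.entryCLM (i j : Fin n) : Matrix (Fin n) (Fin n) ℝ →L[ℝ] ℝ :=
  LinearMap.toContinuousLinearMap (Matrix.entryLinearMap ℝ ℝ i j)

/-- Links the entrywise derivatives of `IsRiccatiSolution` to the normed algebra of matrices, where
product and inverse rules are available. -/
theorem Matrix.hasDerivWithinAt_iff {M : ℝ → Matrix (Fin n) (Fin n) ℝ}
    {M' : Matrix (Fin n) (Fin n) ℝ} {s : Set ℝ} {t : ℝ} :
    HasDerivWithinAt M M' s t ↔
      ∀ i j, HasDerivWithinAt (fun u => M u i j) (M' i j) s t := by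
  constructor
  · intro h i j
    exact (Matrix.entryCLM i j).hasFDerivAt.comp_hasDerivWithinAt t h
  · intro h
    have key : HasDerivWithinAt (fun u => ∑ i, ∑ j, M u i j • Matrix.single i j (1 : ℝ))
        (∑ i, ∑ j, M' i j • Matrix.single i j (1 : ℝ)) s t :=
      HasDerivWithinAt.fun_sum fun i _ => HasDerivWithinAt.fun_sum fun j _ =>
        (h i j).smul_const _
    have e : ∀ N : Matrix (Fin n) (Fin n) ℝ,
        ∑ i, ∑ j, N i j • Matrix.single i j (1 : ℝ) = N := by
      intro N
      conv_rhs => rw [Matrix.matrix_eq_sum_single N]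
      simp
    simpa only [e] using key

theorem Matrix.hasDerivWithinAt_transpose {M : ℝ → Matrix (Fin n) (Fin n) ℝ}
    {M' : Matrix (Fin n) (Fin n) ℝ} {s : Set ℝ} {t : ℝ} (h : HasDerivWithinAt M M' s t) :
    HasDerivWithinAt (fun u => (M u)ᵀ) M'ᵀ s t :=
  Matrix.hasDerivWithinAt_iff.2 fun i j => Matrix.hasDerivWithinAt_iff.1 h j i

theorem Matrix.hasDerivWithinAt_inv {M : ℝ → Matrix (Fin n) (Fin n) ℝ}
    {M' : Matrix (Fin n) (Fin n) ℝ} {s : Set ℝ} {t : ℝ} (h : HasDerivWithinAt M M' s t)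
    (hu : IsUnit (M t)) :
    HasDerivWithinAt (fun u => (M u)⁻¹) (-((M t)⁻¹ * M' * (M t)⁻¹)) s t := by
  obtain ⟨u, hu⟩ := hu
  have h1 := hasFDerivAt_ringInverse (𝕜 := ℝ) u
  rw [hu] at h1
  have h2 := h1.comp_hasDerivWithinAt t h
  have e : (fun u => (M u)⁻¹) = Ring.inverse ∘ M := by
    funext u; simp [Matrix.nonsing_inv_eq_ringInverse]
  rw [e]
  convert! h2 using 1
  rw [← hu, ← Matrix.coe_units_inv]
  simp [ContinuousLinearMap.mulLeftRight_apply]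

theorem exists_flow_of_continuousLinearMap {E : Type*} [NormedAddCommGroup E] [NormedSpace ℝ E]
    [CompleteSpace E] (L : E →L[ℝ] E) (z₀ : E) :
    ∃ Z : ℝ → E, Z 0 = z₀ ∧ ∀ t, HasDerivAt Z (L (Z t)) t := by
  refine ⟨fun t => NormedSpace.exp (t • L) z₀, by simp, fun t => ?_⟩
  have h := hasDerivAt_exp_smul_const' (𝕂 := ℝ) L t
  exact ((ContinuousLinearMap.apply ℝ E z₀).hasFDerivAt
    (x := NormedSpace.exp (t • L))).comp_hasDerivAt t h

/-- The generator `(X, Y) ↦ (-Aᵀ X + G Y, W X + A Y)` of the linear Hamiltonian system attached to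
a matrix Riccati equation. -/
def hamiltonianGenerator (A G W : Matrix (Fin n) (Fin n) ℝ) :
    Matrix (Fin n) (Fin n) ℝ × Matrix (Fin n) (Fin n) ℝ →ₗ[ℝ]
      Matrix (Fin n) (Fin n) ℝ × Matrix (Fin n) (Fin n) ℝ where
  toFun p := (-Aᵀ * p.1 + G * p.2, W * p.1 + A * p.2)
  map_add' p q := by
    ext1
    · simp only [Prod.fst_add, Prod.snd_add, mul_add]; abel
    · simp only [Prod.fst_add, Prod.snd_add, mul_add]; abel
  map_smul' c p := by
    ext1 <;> simp

/-- The linear Hamiltonian system attached to a matrix Riccati equation has global solutions. -/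
theorem exists_hamiltonian_flow (A G W Γ : Matrix (Fin n) (Fin n) ℝ) :
    ∃ X Y : ℝ → Matrix (Fin n) (Fin n) ℝ, X 0 = 1 ∧ Y 0 = Γ ∧
      (∀ t, HasDerivAt X (-Aᵀ * X t + G * Y t) t) ∧
      ∀ t, HasDerivAt Y (W * X t + A * Y t) t := by
  have : CompleteSpace (Matrix (Fin n) (Fin n) ℝ × Matrix (Fin n) (Fin n) ℝ) :=
    FiniteDimensional.complete ℝ _
  obtain ⟨Z, h0, hZ⟩ := exists_flow_of_continuousLinearMap
    (LinearMap.toContinuousLinearMap (hamiltonianGenerator A G W)) (1, Γ)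
  refine ⟨fun t => (Z t).1, fun t => (Z t).2, by simp [h0], by simp [h0], fun t => ?_, fun t => ?_⟩
  · exact (ContinuousLinearMap.fst ℝ _ _).hasFDerivAt.comp_hasDerivAt t (hZ t)
  · exact (ContinuousLinearMap.snd ℝ _ _).hasFDerivAt.comp_hasDerivAt t (hZ t)

/-- The derivative of `XᵀY` is `YᵀGY + XᵀWX`, symmetric and positive semidefinite. Hence the skew
part keeps its initial value `0`, and every quadratic form of `XᵀY` is nondecreasing from that of
`Γ`. This rules out blow-up of `Y X⁻¹` in forward time. -/
theorem posDef_transpose_mul_of_hamiltonian_flow {A G W Γ : Matrix (Fin n) (Fin n) ℝ}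
    (hG : G.PosSemidef) (hW : W.PosSemidef) (hΓ : Γ.PosDef)
    {X Y : ℝ → Matrix (Fin n) (Fin n) ℝ} (hX0 : X 0 = 1) (hY0 : Y 0 = Γ)
    (hX : ∀ t, HasDerivAt X (-Aᵀ * X t + G * Y t) t)
    (hY : ∀ t, HasDerivAt Y (W * X t + A * Y t) t) {t : ℝ} (ht : 0 ≤ t) :
    ((X t)ᵀ * Y t).PosDef := by
  have hGs : Gᵀ = G := by simpa using hG.isHermitian.eq
  have hWs : Wᵀ = W := by simpa using hW.isHermitian.eq
  have hΓs : Γᵀ = Γ := by simpa using hΓ.isHermitian.eq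
  have hT : ∀ {M : ℝ → Matrix (Fin n) (Fin n) ℝ} {M' : Matrix (Fin n) (Fin n) ℝ} {t : ℝ},
      HasDerivAt M M' t → HasDerivAt (fun u => (M u)ᵀ) M'ᵀ t := by
    intro M M' t h
    exact hasDerivWithinAt_univ.1 (Matrix.hasDerivWithinAt_transpose (hasDerivWithinAt_univ.2 h))
  have hD : ∀ t, HasDerivAt (fun u => (X u)ᵀ * Y u)
      ((Y t)ᵀ * G * Y t + (X t)ᵀ * W * X t) t := by
    intro t
    convert! (hT (hX t)).mul (hY t) using 1
    simp only [transpose_add, transpose_mul, transpose_neg, transpose_transpose, hGs]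
    noncomm_ring
  have hD' : ∀ t, HasDerivAt (fun u => (X u)ᵀ * Y u - ((X u)ᵀ * Y u)ᵀ) 0 t := by
    intro t
    convert! (hD t).sub (hT (hD t)) using 1
    simp only [transpose_add, transpose_mul, transpose_transpose, hGs, hWs]
    noncomm_ring
  have hsymm : ((X t)ᵀ * Y t)ᵀ = (X t)ᵀ * Y t := by
    have := is_const_of_deriv_eq_zero (fun t => (hD' t).differentiableAt)
      (fun t => (hD' t).deriv) t 0
    simp only [hX0, hY0, transpose_one, one_mul, hΓs, sub_self] at this
    exact (sub_eq_zero.1 this).symm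
  refine Matrix.PosDef.of_dotProduct_mulVec_pos (by simpa [Matrix.IsHermitian] using hsymm) ?_
  intro v hv
  let q : Matrix (Fin n) (Fin n) ℝ →L[ℝ] ℝ := LinearMap.toContinuousLinearMap
    { toFun := fun M => v ⬝ᵥ (M *ᵥ v)
      map_add' := fun M N => by simp [add_mulVec]
      map_smul' := fun c M => by simp [smul_mulVec] }
  have hq : ∀ t, HasDerivAt (fun u => q ((X u)ᵀ * Y u))
      (q ((Y t)ᵀ * G * Y t + (X t)ᵀ * W * X t)) t := fun t =>
    q.hasFDerivAt.comp_hasDerivAt t (hD t)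
  have hmono : Monotone (fun u => q ((X u)ᵀ * Y u)) := by
    refine monotone_of_deriv_nonneg (fun t => (hq t).differentiableAt) fun t => ?_
    rw [(hq t).deriv]
    have h1 := (hG.conjTranspose_mul_mul_same (Y t)).add (hW.conjTranspose_mul_mul_same (X t))
    exact h1.dotProduct_mulVec_nonneg v
  have h0 := hmono ht
  simp only [hX0, hY0, transpose_one, one_mul] at h0
  have h1 := hΓ.dotProduct_mulVec_pos hv
  simp only [star_trivial] at h1 ⊢
  exact lt_of_lt_of_le h1 h0

theorem isUnit_of_posDef_transpose_mul {X Y : Matrix (Fin n) (Fin n) ℝ} (h : (Xᵀ * Y).PosDef) :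
    IsUnit X := by
  have h1 := h.isUnit
  rw [Matrix.isUnit_iff_isUnit_det] at h1 ⊢
  rw [det_mul, det_transpose] at h1
  exact isUnit_of_mul_isUnit_left h1

end MatrixCalculus

/-! ### The Riccati equation: global existence, positivity, precision matrices. -/

namespace UncertainSystem

open scoped Matrix.Norms.Operator

variable {ι : Type*} {n m r : ℕ} (S : UncertainSystem ι n m r)

theorem output_gram_posSemidef (k : ι) : (S.Cᵀ * (S.Q k)⁻¹ * S.C).PosSemidef := by
  simpa using (S.Q_posDef k).inv.posSemidef.conjTranspose_mul_mul_same S.C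

theorem input_gram_posSemidef (k : ι) : (S.B * S.R k * S.Bᵀ).PosSemidef := by
  simpa using (S.R_posDef k).posSemidef.mul_mul_conjTranspose_same S.B

/-- The right-hand side of the Riccati equation. -/
noncomputable def riccatiRHS (k : ι) (M : Matrix (Fin n) (Fin n) ℝ) : Matrix (Fin n) (Fin n) ℝ :=
  S.A k * M + M * (S.A k)ᵀ - M * S.Cᵀ * (S.Q k)⁻¹ * S.C * M + S.B * S.R k * S.Bᵀ

theorem isRiccatiSolution_iff {k : ι} {M : ℝ → Matrix (Fin n) (Fin n) ℝ} :
    S.IsRiccatiSolution k M ↔ M 0 = S.Γ k ∧ ∀ t ∈ Icc 0 S.T,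
      HasDerivWithinAt M (S.riccatiRHS k (M t)) (Icc 0 S.T) t := by
  simp only [IsRiccatiSolution, Matrix.hasDerivWithinAt_iff, riccatiRHS]

/-- The solution is `Y X⁻¹`, which linearizes the quadratic equation. -/
theorem exists_isRiccatiSolution (k : ι) : ∃ M, S.IsRiccatiSolution k M := by
  obtain ⟨X, Y, hX0, hY0, hX, hY⟩ := exists_hamiltonian_flow (S.A k)
    (S.Cᵀ * (S.Q k)⁻¹ * S.C) (S.B * S.R k * S.Bᵀ) (S.Γ k)
  refine ⟨fun t => Y t * (X t)⁻¹, S.isRiccatiSolution_iff.2 ⟨by simp [hX0, hY0], fun t ht => ?_⟩⟩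
  have hpd := posDef_transpose_mul_of_hamiltonian_flow (S.output_gram_posSemidef k)
    (S.input_gram_posSemidef k) (S.Γ_posDef k) hX0 hY0 hX hY ht.1
  have hu : IsUnit (X t) := isUnit_of_posDef_transpose_mul hpd
  have hu' : X t * (X t)⁻¹ = 1 :=
    Matrix.mul_nonsing_inv _ ((Matrix.isUnit_iff_isUnit_det _).1 hu)
  have h := (hY t).hasDerivWithinAt.mul
    (Matrix.hasDerivWithinAt_inv (hX t).hasDerivWithinAt (s := Icc 0 S.T) hu)
  convert! h using 1
  have e1 : (S.B * S.R k * S.Bᵀ * X t + S.A k * Y t) * (X t)⁻¹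
      = S.B * S.R k * S.Bᵀ + S.A k * (Y t * (X t)⁻¹) := by
    rw [add_mul, mul_assoc (S.B * S.R k * S.Bᵀ), hu', mul_one, mul_assoc (S.A k)]
  have e2 : (X t)⁻¹ * (-(S.A k)ᵀ * X t + S.Cᵀ * (S.Q k)⁻¹ * S.C * Y t) * (X t)⁻¹
      = -(X t)⁻¹ * (S.A k)ᵀ + (X t)⁻¹ * (S.Cᵀ * (S.Q k)⁻¹ * S.C) * (Y t * (X t)⁻¹) := by
    have : (X t)⁻¹ * (-(S.A k)ᵀ * X t + S.Cᵀ * (S.Q k)⁻¹ * S.C * Y t) * (X t)⁻¹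
      = -(X t)⁻¹ * (S.A k)ᵀ * (X t * (X t)⁻¹)
        + (X t)⁻¹ * (S.Cᵀ * (S.Q k)⁻¹ * S.C) * (Y t * (X t)⁻¹) := by noncomm_ring
    rw [this, hu', mul_one]
  rw [e1, e2, riccatiRHS]
  simp only [Matrix.mul_assoc, Matrix.mul_neg, Matrix.neg_mul, Matrix.mul_add]
  abel

theorem covariance_spec (k : ι) : S.IsRiccatiSolution k (S.covariance k) :=
  Classical.epsilon_spec (S.exists_isRiccatiSolution k)

theorem hasDerivWithinAt_covariance (k : ι) {t : ℝ} (ht : t ∈ Icc 0 S.T) :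
    HasDerivWithinAt (S.covariance k) (S.riccatiRHS k (S.covariance k t)) (Icc 0 S.T) t :=
  (S.isRiccatiSolution_iff.1 (S.covariance_spec k)).2 t ht

theorem continuousOn_covariance (k : ι) : ContinuousOn (S.covariance k) (Icc 0 S.T) :=
  fun _ ht => (S.hasDerivWithinAt_covariance k ht).continuousWithinAt

/-- The closed-loop matrix `A - Π Cᵀ Q⁻¹ C` of the Kalman filter. -/
noncomputable def closedLoop (k : ι) (t : ℝ) : Matrix (Fin n) (Fin n) ℝ :=
  S.A k - S.covariance k t * (S.Cᵀ * (S.Q k)⁻¹ * S.C)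

theorem continuousOn_closedLoop (k : ι) : ContinuousOn (S.closedLoop k) (Icc 0 S.T) :=
  continuousOn_const.sub ((S.continuousOn_covariance k).mul continuousOn_const)

/-- The Hamiltonian flow factors through the covariance. -/
theorem exists_dual_fundamental_and_posDef (k : ι) :
    ∃ X : ℝ → Matrix (Fin n) (Fin n) ℝ, X 0 = 1 ∧ ∀ t ∈ Icc 0 S.T,
      IsUnit (X t) ∧ (S.covariance k t).PosDef ∧
      HasDerivWithinAt X (-(S.closedLoop k t)ᵀ * X t) (Icc 0 S.T) t := by
  have hG := S.output_gram_posSemidef k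
  obtain ⟨X, Y, hX0, hY0, hX, hY⟩ := exists_hamiltonian_flow (S.A k)
    (S.Cᵀ * (S.Q k)⁻¹ * S.C) (S.B * S.R k * S.Bᵀ) (S.Γ k)
  -- The chosen `covariance` is not known to be `Y X⁻¹`. The defect `Y - ΠX` solves a homogeneous
  -- linear equation with zero initial value, so a Grönwall argument makes it vanish.
  have hE : ∀ t ∈ Icc 0 S.T, HasDerivWithinAt (fun t => Y t - S.covariance k t * X t)
      (S.closedLoop k t * (Y t - S.covariance k t * X t)) (Icc 0 S.T) t := by
    intro t ht
    convert! (hY t).hasDerivWithinAt.sub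
      ((S.hasDerivWithinAt_covariance k ht).mul (hX t).hasDerivWithinAt) using 1
    simp only [riccatiRHS, closedLoop, Matrix.mul_assoc, Matrix.mul_neg, Matrix.neg_mul,
      Matrix.mul_add, Matrix.add_mul, Matrix.sub_mul, Matrix.mul_sub]
    abel
  obtain ⟨K, hK⟩ := isCompact_Icc.exists_bound_of_continuousOn (S.continuousOn_closedLoop k)
  have hzero : ∀ t ∈ Icc 0 S.T, Y t - S.covariance k t * X t = 0 := by
    refine eq_zero_of_abs_deriv_le_mul_abs_self_of_eq_zero_right (K := K)
      (f' := fun t => S.closedLoop k t * (Y t - S.covariance k t * X t))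
      (fun t ht => (hE t ht).continuousWithinAt) (fun t ht => ?_) ?_ (fun t ht => ?_)
    · exact (hE t (Ico_subset_Icc_self ht)).mono_of_mem_nhdsWithin (Icc_mem_nhdsGE_of_mem ht)
    · rw [hX0, hY0, (S.covariance_spec k).1, mul_one, sub_self]
    · exact (norm_mul_le _ _).trans
        (mul_le_mul_of_nonneg_right (hK t (Ico_subset_Icc_self ht)) (norm_nonneg _))
  refine ⟨X, hX0, fun t ht => ?_⟩
  have hpd := posDef_transpose_mul_of_hamiltonian_flow hG
    (S.input_gram_posSemidef k) (S.Γ_posDef k) hX0 hY0 hX hY ht.1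
  have hu : IsUnit (X t) := isUnit_of_posDef_transpose_mul hpd
  have hYt : Y t = S.covariance k t * X t := sub_eq_zero.1 (hzero t ht)
  -- `XᵀΠX = XᵀY` is a congruence by the invertible `X`, so positivity descends to `Π`.
  have hcov : (S.covariance k t).PosDef := by
    rw [hYt, ← mul_assoc] at hpd
    exact (Matrix.IsUnit.posDef_star_left_conjugate_iff hu).1 hpd
  refine ⟨hu, hcov, ?_⟩
  have hs : (S.covariance k t)ᵀ = S.covariance k t := by simpa using hcov.isHermitian.eq
  have hGs : (S.Cᵀ * (S.Q k)⁻¹ * S.C)ᵀ = S.Cᵀ * (S.Q k)⁻¹ * S.C := by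
    simpa using hG.isHermitian.eq
  convert! (hX t).hasDerivWithinAt using 1
  rw [closedLoop, transpose_sub, transpose_mul, hGs, hs, hYt]
  noncomm_ring

theorem covariance_posDef (k : ι) {t : ℝ} (ht : t ∈ Icc 0 S.T) : (S.covariance k t).PosDef := by
  obtain ⟨X, -, h⟩ := S.exists_dual_fundamental_and_posDef k
  exact (h t ht).2.1

/-- A fundamental matrix `Φ` of the closed-loop system and its inverse `Ψ`. -/
theorem exists_fundamental (k : ι) :
    ∃ Φ Ψ : ℝ → Matrix (Fin n) (Fin n) ℝ, Φ 0 = 1 ∧ ContinuousOn Ψ (Icc 0 S.T) ∧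
      ∀ t ∈ Icc 0 S.T, Φ t * Ψ t = 1 ∧
        HasDerivWithinAt Φ (S.closedLoop k t * Φ t) (Icc 0 S.T) t := by
  obtain ⟨X, hX0, h⟩ := S.exists_dual_fundamental_and_posDef k
  -- `X` solves the adjoint of the closed-loop equation, so its inverse transpose solves the
  -- closed-loop equation itself.
  refine ⟨fun t => ((X t)⁻¹)ᵀ, fun t => (X t)ᵀ, by simp [hX0], fun t ht => ?_, fun t ht => ?_⟩
  · exact (Matrix.hasDerivWithinAt_transpose (h t ht).2.2).continuousWithinAt
  · have hu : IsUnit (X t).det := (Matrix.isUnit_iff_isUnit_det _).1 (h t ht).1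
    refine ⟨by simp only [← transpose_mul, Matrix.mul_nonsing_inv _ hu, transpose_one], ?_⟩
    convert! Matrix.hasDerivWithinAt_transpose
      (Matrix.hasDerivWithinAt_inv (h t ht).2.2 (h t ht).1) using 1
    rw [← mul_assoc, mul_assoc, Matrix.mul_nonsing_inv _ hu]
    simp [transpose_mul]

theorem precision_posDef (k : ι) {t : ℝ} (ht : t ∈ Icc 0 S.T) : (S.precision k t).PosDef :=
  (S.covariance_posDef k ht).inv

theorem hasDerivWithinAt_precision_formula (k : ι) {t : ℝ} (ht : t ∈ Icc 0 S.T) :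
    HasDerivWithinAt (S.precision k)
      (-(S.precision k t * S.riccatiRHS k (S.covariance k t) * S.precision k t)) (Icc 0 S.T) t :=
  Matrix.hasDerivWithinAt_inv (S.hasDerivWithinAt_covariance k ht)
    (S.covariance_posDef k ht).isUnit

theorem precisionDeriv_eq (k : ι) {t : ℝ} (ht : t ∈ Icc 0 S.T) : S.precisionDeriv k t =
    -(S.precision k t * S.riccatiRHS k (S.covariance k t) * S.precision k t) := by
  ext i j
  exact (Matrix.hasDerivWithinAt_iff.1 (S.hasDerivWithinAt_precision_formula k ht) i j).derivWithin
    (uniqueDiffOn_Icc S.T_pos t ht)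

theorem hasDerivWithinAt_precision (k : ι) {t : ℝ} (ht : t ∈ Icc 0 S.T) :
    HasDerivWithinAt (S.precision k) (S.precisionDeriv k t) (Icc 0 S.T) t := by
  rw [S.precisionDeriv_eq k ht]
  exact S.hasDerivWithinAt_precision_formula k ht

theorem continuousOn_precision (k : ι) : ContinuousOn (S.precision k) (Icc 0 S.T) :=
  fun _ ht => (S.hasDerivWithinAt_precision k ht).continuousWithinAt

theorem continuousOn_precisionDeriv (k : ι) :
    ContinuousOn (S.precisionDeriv k) (Icc 0 S.T) := by
  have hP := S.continuousOn_precision k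
  have hC := S.continuousOn_covariance k
  refine ContinuousOn.congr (f := fun t =>
    -(S.precision k t * S.riccatiRHS k (S.covariance k t) * S.precision k t)) ?_
    fun t ht => S.precisionDeriv_eq k ht
  unfold riccatiRHS
  have h1 : ContinuousOn (fun t => S.covariance k t * S.Cᵀ * (S.Q k)⁻¹ * S.C * S.covariance k t)
      (Icc 0 S.T) := by
    have : ContinuousOn (fun t => S.covariance k t * (S.Cᵀ * (S.Q k)⁻¹ * S.C) * S.covariance k t)
      (Icc 0 S.T) := (hC.mul continuousOn_const).mul hC
    simpa only [Matrix.mul_assoc] using this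
  exact ((hP.mul ((((continuousOn_const.mul hC).add (hC.mul continuousOn_const)).sub h1).add
    continuousOn_const)).mul hP).neg

end UncertainSystem

/-! ### Absolutely continuous functions and weak derivatives. -/

section AbsolutelyContinuous

open AbsolutelyContinuousOnInterval Filter
open scoped NNReal

/-- A function whose increments over short intervals are dominated by those of an absolutely
continuous function is absolutely continuous. -/
theorem AbsolutelyContinuousOnInterval.of_dist_le {X Y : Type*} [PseudoMetricSpace X]
    [PseudoMetricSpace Y] {f : ℝ → X} {g : ℝ → Y} {a b K δ : ℝ} (hδ : 0 < δ)
    (hg : AbsolutelyContinuousOnInterval g a b)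
    (h : ∀ s ∈ uIcc a b, ∀ t ∈ uIcc a b, dist s t < δ →
      dist (f s) (f t) ≤ K * dist (g s) (g t)) :
    AbsolutelyContinuousOnInterval f a b := by
  rw [absolutelyContinuousOnInterval_iff] at hg ⊢
  intro ε hε
  -- `|K| + 1` is positive whatever the sign of `K`.
  obtain ⟨η, hη, H⟩ := hg (ε / (|K| + 1)) (by positivity)
  refine ⟨min η δ, lt_min hη hδ, fun E hE hlen => ?_⟩
  have h1 := H E hE (hlen.trans_le (min_le_left _ _))
  calc ∑ i ∈ Finset.range E.1, dist (f (E.2 i).1) (f (E.2 i).2)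
      ≤ ∑ i ∈ Finset.range E.1, (|K| + 1) * dist (g (E.2 i).1) (g (E.2 i).2) := by
        refine Finset.sum_le_sum fun i hi => ?_
        refine (h _ (hE.1 i hi).1 _ (hE.1 i hi).2 ?_).trans ?_
        · refine lt_of_le_of_lt ?_ (hlen.trans_le (min_le_right _ _))
          exact Finset.single_le_sum (f := fun i => dist (E.2 i).1 (E.2 i).2)
            (fun _ _ => dist_nonneg) hi
        · gcongr
          linarith [le_abs_self K]
    _ = (|K| + 1) * ∑ i ∈ Finset.range E.1, dist (g (E.2 i).1) (g (E.2 i).2) := by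
        rw [Finset.mul_sum]
    _ < (|K| + 1) * (ε / (|K| + 1)) := by gcongr
    _ = ε := by field_simp

theorem AbsolutelyContinuousOnInterval.pi {κ : Type*} [Fintype κ] {X : κ → Type*}
    [∀ i, PseudoMetricSpace (X i)] {f : ℝ → ∀ i, X i} {a b : ℝ}
    (h : ∀ i, AbsolutelyContinuousOnInterval (fun t => f t i) a b) :
    AbsolutelyContinuousOnInterval f a b := by
  have hsum := tendsto_finsetSum (Finset.univ : Finset κ) fun i _ => h i
  rw [Finset.sum_const_zero] at hsum
  refine squeeze_zero (fun E => Finset.sum_nonneg fun _ _ => dist_nonneg) (fun E => ?_) hsum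
  rw [Finset.sum_comm]
  refine Finset.sum_le_sum fun j _ => ?_
  rw [dist_pi_le_iff (Finset.sum_nonneg fun _ _ => dist_nonneg)]
  intro i
  exact Finset.single_le_sum (f := fun i => dist (f (E.2 j).1 i) (f (E.2 j).2 i))
    (fun _ _ => dist_nonneg) (Finset.mem_univ i)

theorem AbsolutelyContinuousOnInterval.prodMk {X Y : Type*} [PseudoMetricSpace X]
    [PseudoMetricSpace Y] {f : ℝ → X} {g : ℝ → Y} {a b : ℝ}
    (hf : AbsolutelyContinuousOnInterval f a b) (hg : AbsolutelyContinuousOnInterval g a b) :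
    AbsolutelyContinuousOnInterval (fun t => (f t, g t)) a b := by
  have hsum := Tendsto.add hf hg
  rw [add_zero] at hsum
  refine squeeze_zero (fun E => Finset.sum_nonneg fun _ _ => dist_nonneg) (fun E => ?_) hsum
  rw [← Finset.sum_add_distrib]
  refine Finset.sum_le_sum fun j _ => ?_
  rw [Prod.dist_eq]
  exact max_le_add_of_nonneg dist_nonneg dist_nonneg

theorem AbsolutelyContinuousOnInterval.eval {κ : Type*} [Fintype κ] {X : κ → Type*}
    [∀ i, PseudoMetricSpace (X i)] {f : ℝ → ∀ i, X i} {a b : ℝ}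
    (h : AbsolutelyContinuousOnInterval f a b) (i : κ) :
    AbsolutelyContinuousOnInterval (fun t => f t i) a b :=
  h.of_dist_le (K := 1) one_pos fun s _ t _ _ => by
    rw [one_mul]; exact dist_le_pi_dist _ _ i

theorem absolutelyContinuousOnInterval_of_hasDerivWithinAt {E : Type*} [NormedAddCommGroup E]
    [NormedSpace ℝ E] {f f' : ℝ → E} {a b : ℝ} (hab : a ≤ b)
    (hf : ∀ t ∈ Icc a b, HasDerivWithinAt f (f' t) (Icc a b) t)
    (hf' : ContinuousOn f' (Icc a b)) : AbsolutelyContinuousOnInterval f a b := by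
  obtain ⟨K, hK⟩ := isCompact_Icc.exists_bound_of_continuousOn hf'
  have hLip : LipschitzOnWith K.toNNReal f (uIcc a b) := by
    rw [uIcc_of_le hab]
    refine (convex_Icc a b).lipschitzOnWith_of_nnnorm_hasDerivWithin_le hf fun t ht => ?_
    rw [← NNReal.coe_le_coe]
    exact (hK t ht).trans (Real.le_coe_toNNReal K)
  exact hLip.absolutelyContinuousOnInterval

theorem ae_deriv_eq_of_ae_hasDerivAt {E : Type*} [NormedAddCommGroup E] [NormedSpace ℝ E]
    {u g : ℝ → E} {a b : ℝ} (hd : ∀ᵐ t, t ∈ Ioo a b → HasDerivAt u (g t) t) :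
    ∀ᵐ t ∂volume.restrict (Ioo a b), deriv u t = g t := by
  rw [ae_restrict_iff' measurableSet_Ioo]
  filter_upwards [hd] with t ht h
  exact (ht h).deriv

/-- Integrability of `g` comes for free: it agrees almost everywhere with `deriv u`, which is
integrable by absolute continuity. -/
theorem AbsolutelyContinuousOnInterval.integrableOn_of_ae_hasDerivAt {u g : ℝ → ℝ} {a b : ℝ}
    (hab : a ≤ b) (hu : AbsolutelyContinuousOnInterval u a b)
    (hd : ∀ᵐ t, t ∈ Ioo a b → HasDerivAt u (g t) t) : IntegrableOn g (Ioo a b) := by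
  have h := hu.intervalIntegrable_deriv
  rw [intervalIntegrable_iff_integrableOn_Ioo_of_le hab] at h
  exact h.congr (ae_deriv_eq_of_ae_hasDerivAt hd)

theorem AbsolutelyContinuousOnInterval.eq_add_integral {u g : ℝ → ℝ} {a b : ℝ}
    (hu : AbsolutelyContinuousOnInterval u a b)
    (hd : ∀ᵐ t, t ∈ Ioo a b → HasDerivAt u (g t) t) {t : ℝ} (ht : t ∈ Icc a b) :
    u t = u a + ∫ s in a..t, g s := by
  have hu' : AbsolutelyContinuousOnInterval u a t := hu.mono (by
    rw [uIcc_of_le ht.1, uIcc_of_le (ht.1.trans ht.2)]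
    exact Icc_subset_Icc_right ht.2)
  have h := hu'.integral_deriv_eq_sub
  have e : ∫ s in a..t, deriv u s = ∫ s in a..t, g s := by
    rw [intervalIntegral.integral_of_le ht.1, intervalIntegral.integral_of_le ht.1,
      integral_Ioc_eq_integral_Ioo, integral_Ioc_eq_integral_Ioo]
    refine integral_congr_ae (ae_deriv_eq_of_ae_hasDerivAt ?_)
    filter_upwards [hd] with s hs h
    exact hs ⟨h.1, h.2.trans_le ht.2⟩
  rw [← e, h]
  ring

/-- Integration by parts of an absolutely continuous function against a test function. -/
theorem AbsolutelyContinuousOnInterval.integral_deriv_mul_test {u g φ : ℝ → ℝ} {a b : ℝ}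
    (hab : a < b) (hu : AbsolutelyContinuousOnInterval u a b)
    (hd : ∀ᵐ t, t ∈ Ioo a b → HasDerivAt u (g t) t) (hφ : ContDiff ℝ ∞ φ)
    (hs : tsupport φ ⊆ Ioo a b) :
    ∫ t in Ioo a b, deriv φ t * u t = -∫ t in Ioo a b, φ t * g t := by
  have hφac : AbsolutelyContinuousOnInterval φ a b :=
    (hφ.of_le (by norm_cast)).contDiffOn.absolutelyContinuousOnInterval
  have h := hφac.integral_mul_deriv_eq_deriv_mul hu
  -- The end points lie outside the support of the test function, so the boundary terms drop out.
  have ha : φ a = 0 := image_eq_zero_of_notMem_tsupport fun h => (lt_irrefl _ (hs h).1)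
  have hb : φ b = 0 := image_eq_zero_of_notMem_tsupport fun h => (lt_irrefl _ (hs h).2)
  rw [ha, hb, intervalIntegral.integral_of_le hab.le, intervalIntegral.integral_of_le hab.le,
    integral_Ioc_eq_integral_Ioo, integral_Ioc_eq_integral_Ioo] at h
  have e : ∫ t in Ioo a b, φ t * deriv u t = ∫ t in Ioo a b, φ t * g t := by
    refine integral_congr_ae ?_
    filter_upwards [ae_deriv_eq_of_ae_hasDerivAt hd] with t ht
    rw [ht]
  rw [← e, h]
  ring

/-- An absolutely continuous function has its almost everywhere derivative as weak derivative. -/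
theorem AbsolutelyContinuousOnInterval.hasWeakDeriv {d : ℕ} {T : ℝ} (hT : 0 < T)
    {u g : ℝ → Fin d → ℝ} (hu : AbsolutelyContinuousOnInterval u 0 T)
    (hd : ∀ᵐ t, t ∈ Ioo 0 T → HasDerivAt u (g t) t) : HasWeakDeriv T u g := by
  have hdi : ∀ i, ∀ᵐ t, t ∈ Ioo 0 T → HasDerivAt (fun s => u s i) (g t i) t := by
    intro i
    filter_upwards [hd] with t ht h
    exact hasDerivAt_pi.1 (ht h) i
  have hg : IntegrableOn g (Ioo 0 T) := integrable_pi_iff.2 fun i =>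
    (hu.eval i).integrableOn_of_ae_hasDerivAt hT.le (hdi i)
  have huc : ContinuousOn u (Icc 0 T) := by simpa [uIcc_of_le hT.le] using hu.continuousOn
  have hui : IntegrableOn u (Ioo 0 T) :=
    (huc.integrableOn_compact isCompact_Icc).mono_set Ioo_subset_Icc_self
  refine ⟨hui.locallyIntegrableOn, hg.locallyIntegrableOn, fun φ hφ hc hs => ?_⟩
  have hb : ∀ {ψ : ℝ → ℝ} {w : ℝ → Fin d → ℝ}, Continuous ψ → IntegrableOn w (Ioo 0 T) →
      IntegrableOn (fun t => ψ t • w t) (Ioo 0 T) := by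
    intro ψ w hψ hw
    rw [← intervalIntegrable_iff_integrableOn_Ioo_of_le hT.le] at hw ⊢
    exact hw.continuousOn_smul hψ.continuousOn
  have h1 := hb (hφ.continuous_deriv (by norm_cast)) hui
  have h2 := hb hφ.continuous hg
  ext i
  rw [Pi.neg_apply, eval_integral (fun j => integrable_pi_iff.1 h1 j),
    eval_integral (fun j => integrable_pi_iff.1 h2 j)]
  simpa using (hu.eval i).integral_deriv_mul_test hT (hdi i) hφ hs

end AbsolutelyContinuous

/-! ### Continuity of matrix products. -/

section MatrixContinuity

variable {a b c : ℕ} {s : Set ℝ}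

theorem ContinuousOn.matrix_mul {M : ℝ → Matrix (Fin a) (Fin b) ℝ}
    {N : ℝ → Matrix (Fin b) (Fin c) ℝ} (hM : ContinuousOn M s) (hN : ContinuousOn N s) :
    ContinuousOn (fun t => M t * N t) s := by
  rw [continuousOn_iff_continuous_domRestrict] at *
  exact Continuous.matrix_mul hM hN

theorem ContinuousOn.matrix_mulVec {M : ℝ → Matrix (Fin a) (Fin b) ℝ}
    {v : ℝ → Fin b → ℝ} (hM : ContinuousOn M s) (hv : ContinuousOn v s) :
    ContinuousOn (fun t => M t *ᵥ v t) s := by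
  rw [continuousOn_iff_continuous_domRestrict] at *
  exact Continuous.matrix_mulVec hM hv

theorem ContinuousOn.matrix_elem {M : ℝ → Matrix (Fin a) (Fin b) ℝ} (hM : ContinuousOn M s)
    (i : Fin a) (j : Fin b) : ContinuousOn (fun t => M t i j) s := fun t ht =>
  (continuous_apply_apply i j).continuousAt.comp_continuousWithinAt (hM t ht)

open scoped Matrix.Norms.Operator in
theorem Matrix.continuousWithinAt_of_hasDerivWithinAt {M : ℝ → Matrix (Fin a) (Fin a) ℝ}
    {M' : Matrix (Fin a) (Fin a) ℝ} {t : ℝ} (h : HasDerivWithinAt M M' s t) :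
    ContinuousWithinAt M s t := h.continuousWithinAt

end MatrixContinuity

/-! ### Carathéodory solutions of the Kalman filter equation. -/

namespace UncertainSystem

variable {ι : Type*} {n m r : ℕ} (S : UncertainSystem ι n m r)

/-- The Kalman gain `Π Cᵀ Q⁻¹`. -/
noncomputable def gain (k : ι) (t : ℝ) : Matrix (Fin n) (Fin r) ℝ :=
  S.covariance k t * S.Cᵀ * (S.Q k)⁻¹

theorem continuousOn_gain (k : ι) : ContinuousOn (S.gain k) (Icc 0 S.T) :=
  ((S.continuousOn_covariance k).matrix_mul continuousOn_const).matrix_mul continuousOn_const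

/-- The right-hand side of the Kalman filter equation. -/
noncomputable def kalmanRHS (y : ℝ → Fin r → ℝ) (k : ι) (x : ℝ → Fin n → ℝ) (s : ℝ) : Fin n → ℝ :=
  S.A k *ᵥ x s + S.gain k s *ᵥ (y s - S.C *ᵥ x s)

theorem kalmanRHS_eq (y : ℝ → Fin r → ℝ) (k : ι) (x : ℝ → Fin n → ℝ) (s : ℝ) :
    S.kalmanRHS y k x s = S.closedLoop k s *ᵥ x s + S.gain k s *ᵥ y s := by
  simp only [kalmanRHS, closedLoop, gain, mulVec_sub, sub_mulVec, mulVec_mulVec, Matrix.mul_assoc]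
  abel

variable {S} {y : ℝ → Fin r → ℝ}

theorem integrableOn_mulVec {d e : ℕ} {T : ℝ} {L : ℝ → Matrix (Fin d) (Fin e) ℝ}
    {w : ℝ → Fin e → ℝ} (hL : ContinuousOn L (Icc 0 T)) (hw : IntegrableOn w (Ioo 0 T)) :
    IntegrableOn (fun s => L s *ᵥ w s) (Ioo 0 T) := by
  rcases le_or_gt T 0 with hT | hT
  · simp [Ioo_eq_empty_of_le hT]
  refine integrable_pi_iff.2 fun i => ?_
  change Integrable (fun s => ∑ j, L s i j * w s j) _
  refine integrable_finsetSum _ fun j _ => ?_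
  have hwj : IntegrableOn (fun s => w s j) (Ioo 0 T) := integrable_pi_iff.1 hw j
  have hLij := hL.matrix_elem i j
  change IntegrableOn (fun s => L s i j * w s j) (Ioo 0 T)
  rw [← intervalIntegrable_iff_integrableOn_Ioo_of_le hT.le] at hwj ⊢
  exact hwj.continuousOn_mul (by rwa [uIcc_of_le hT.le])

/-- Variation of constants: `x = Φ (x₀ + ∫ Ψ Π Cᵀ Q⁻¹ y)`. Each component is absolutely continuous,
so the equation, which the product rule gives only almost everywhere, integrates to the Carathéodory
form. -/
theorem exists_isKalmanFilter (hy : IntegrableOn y (Ioo 0 S.T)) (k : ι) :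
    ∃ x, S.IsKalmanFilter y k x := by
  obtain ⟨Φ, Ψ, hΦ0, hΨ, h⟩ := S.exists_fundamental k
  have hL : ContinuousOn (fun s => Ψ s * S.gain k s) (Icc 0 S.T) :=
    hΨ.matrix_mul (S.continuousOn_gain k)
  set f : ℝ → Fin n → ℝ := fun s => (Ψ s * S.gain k s) *ᵥ y s with hf
  have hfi : ∀ j, IntervalIntegrable (fun s => f s j) volume 0 S.T := fun j =>
    (intervalIntegrable_iff_integrableOn_Ioo_of_le S.T_pos.le).2
      (integrable_pi_iff.1 (integrableOn_mulVec hL hy) j)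
  set z : ℝ → Fin n → ℝ := fun t j => S.x₀ j + ∫ s in (0 : ℝ)..t, f s j with hz
  have hzac : ∀ j, AbsolutelyContinuousOnInterval (fun t => z t j) 0 S.T := fun j =>
    ((hfi j).absolutelyContinuousOnInterval_intervalIntegral (c := 0) (by simp)).of_dist_le
      (K := 1) one_pos fun s _ t _ _ => by simp [hz]
  have hΦc : ContinuousOn (fun t => S.closedLoop k t * Φ t) (Icc 0 S.T) :=
    (S.continuousOn_closedLoop k).matrix_mul fun t ht =>
      Matrix.continuousWithinAt_of_hasDerivWithinAt (h t ht).2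
  have hΦac : ∀ i j, AbsolutelyContinuousOnInterval (fun t => Φ t i j) 0 S.T := fun i j =>
    absolutelyContinuousOnInterval_of_hasDerivWithinAt S.T_pos.le
      (fun t ht => Matrix.hasDerivWithinAt_iff.1 (h t ht).2 i j)
      (hΦc.matrix_elem i j)
  have hxac : ∀ i, AbsolutelyContinuousOnInterval (fun t => (Φ t *ᵥ z t) i) 0 S.T := by
    intro i
    -- Absolute continuity is available for binary sums and products; induction extends it to the
    -- sum defining `*ᵥ`.
    have : ∀ s : Finset (Fin n),
        AbsolutelyContinuousOnInterval (fun t => ∑ j ∈ s, Φ t i j * z t j) 0 S.T := by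
      classical
      intro s
      induction s using Finset.induction_on with
      | empty =>
        simpa using (hzac i).const_mul 0
      | insert j s hj ih =>
        simp only [Finset.sum_insert hj]
        exact ((hΦac i j).fun_mul (hzac j)).fun_add ih
    exact this Finset.univ
  have hder : ∀ᵐ t, t ∈ Ioo 0 S.T → HasDerivAt (fun t => Φ t *ᵥ z t)
      (S.kalmanRHS y k (fun t => Φ t *ᵥ z t) t) t := by
    have hzd : ∀ j, ∀ᵐ t, t ∈ Ioo 0 S.T → HasDerivAt (fun t => z t j) (f t j) t := by
      intro j
      filter_upwards [(hfi j).ae_hasDerivAt_integral] with t ht hmem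
      refine (ht ?_ 0 (by simp)).const_add _
      rw [uIcc_of_le S.T_pos.le]; exact Ioo_subset_Icc_self hmem
    filter_upwards [ae_all_iff.2 hzd] with t ht hmem
    have hmem' := Ioo_subset_Icc_self hmem
    rw [hasDerivAt_pi]
    intro i
    have h1 : ∀ j, HasDerivAt (fun t => Φ t i j * z t j)
        ((S.closedLoop k t * Φ t) i j * z t j + Φ t i j * f t j) t := fun j =>
      ((Matrix.hasDerivWithinAt_iff.1 (h t hmem').2 i j).hasDerivAt
        (Icc_mem_nhds hmem.1 hmem.2)).mul (ht j hmem)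
    convert! HasDerivAt.fun_sum (u := Finset.univ) fun j _ => h1 j using 1
    have e : Φ t *ᵥ f t = S.gain k t *ᵥ y t := by
      rw [hf, mulVec_mulVec, ← Matrix.mul_assoc, (h t hmem').1, Matrix.one_mul]
    rw [S.kalmanRHS_eq, Finset.sum_add_distrib, ← e, mulVec_mulVec]
    rfl
  have hderi : ∀ i, ∀ᵐ t, t ∈ Ioo 0 S.T → HasDerivAt (fun t => (Φ t *ᵥ z t) i)
      (S.kalmanRHS y k (fun t => Φ t *ᵥ z t) t i) t := by
    intro i
    filter_upwards [hder] with t ht hmem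
    exact hasDerivAt_pi.1 (ht hmem) i
  refine ⟨fun t => Φ t *ᵥ z t, ?_, fun t ht => ?_⟩
  · have := (AbsolutelyContinuousOnInterval.pi hxac).continuousOn
    rwa [uIcc_of_le S.T_pos.le] at this
  · have hint : IntervalIntegrable (S.kalmanRHS y k fun t => Φ t *ᵥ z t) volume 0 t := by
      rw [intervalIntegrable_iff_integrableOn_Ioo_of_le ht.1]
      refine IntegrableOn.mono_set (t := Ioo 0 S.T) (integrable_pi_iff.2 fun i => ?_)
        (Ioo_subset_Ioo_right ht.2)
      exact (hxac i).integrableOn_of_ae_hasDerivAt S.T_pos.le (hderi i)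
    change _ = S.x₀ + ∫ s in (0 : ℝ)..t, S.kalmanRHS y k (fun t => Φ t *ᵥ z t) s
    ext i
    refine ((hxac i).eq_add_integral (hderi i) ht).trans ?_
    rw [Pi.add_apply]
    congr 1
    · simp [hΦ0, hz]
    · exact (ContinuousLinearMap.proj (R := ℝ) (φ := fun _ : Fin n => ℝ) i).intervalIntegral_comp_comm
        hint

theorem kalman_spec (hy : IntegrableOn y (Ioo 0 S.T)) (k : ι) :
    S.IsKalmanFilter y k (S.kalman y k) :=
  Classical.epsilon_spec (exists_isKalmanFilter hy k)

theorem continuousOn_kalman (hy : IntegrableOn y (Ioo 0 S.T)) (k : ι) :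
    ContinuousOn (S.kalman y k) (Icc 0 S.T) := (kalman_spec hy k).1

theorem kalman_eq (hy : IntegrableOn y (Ioo 0 S.T)) (k : ι) {t : ℝ} (ht : t ∈ Icc 0 S.T) :
    S.kalman y k t = S.x₀ + ∫ s in (0 : ℝ)..t, S.kalmanRHS y k (S.kalman y k) s :=
  (kalman_spec hy k).2 t ht

theorem integrableOn_kalmanRHS (hy : IntegrableOn y (Ioo 0 S.T)) (k : ι) :
    IntegrableOn (S.kalmanRHS y k (S.kalman y k)) (Ioo 0 S.T) := by
  have e : S.kalmanRHS y k (S.kalman y k) =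
      fun s => S.closedLoop k s *ᵥ S.kalman y k s + S.gain k s *ᵥ y s := by
    funext s; exact S.kalmanRHS_eq y k _ s
  rw [e]
  have hk : IntegrableOn (S.kalman y k) (Ioo 0 S.T) :=
    ((continuousOn_kalman hy k).integrableOn_compact isCompact_Icc).mono_set Ioo_subset_Icc_self
  exact (integrableOn_mulVec (S.continuousOn_closedLoop k) hk).add
    (integrableOn_mulVec (S.continuousOn_gain k) hy)

theorem intervalIntegrable_kalmanRHS (hy : IntegrableOn y (Ioo 0 S.T)) (k : ι) :
    IntervalIntegrable (S.kalmanRHS y k (S.kalman y k)) volume 0 S.T :=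
  (intervalIntegrable_iff_integrableOn_Ioo_of_le S.T_pos.le).2 (integrableOn_kalmanRHS hy k)

theorem kalman_apply_eq (hy : IntegrableOn y (Ioo 0 S.T)) (k : ι) (i : Fin n) {t : ℝ}
    (ht : t ∈ Icc 0 S.T) : S.kalman y k t i =
      S.x₀ i + ∫ s in (0 : ℝ)..t, S.kalmanRHS y k (S.kalman y k) s i := by
  rw [kalman_eq hy k ht, Pi.add_apply]
  congr 1
  refine ((ContinuousLinearMap.proj (R := ℝ)
    (φ := fun _ : Fin n => ℝ) i).intervalIntegral_comp_comm ?_).symm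
  refine (intervalIntegrable_kalmanRHS hy k).mono_set ?_
  rw [uIcc_of_le ht.1, uIcc_of_le S.T_pos.le]
  exact Icc_subset_Icc_right ht.2

theorem absolutelyContinuousOnInterval_kalman (hy : IntegrableOn y (Ioo 0 S.T)) (k : ι) :
    AbsolutelyContinuousOnInterval (S.kalman y k) 0 S.T := by
  refine AbsolutelyContinuousOnInterval.pi fun i => ?_
  have hint : IntervalIntegrable (fun s => S.kalmanRHS y k (S.kalman y k) s i) volume 0 S.T :=
    (intervalIntegrable_iff_integrableOn_Ioo_of_le S.T_pos.le).2
      (integrable_pi_iff.1 (integrableOn_kalmanRHS hy k) i)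
  refine (hint.absolutelyContinuousOnInterval_intervalIntegral (c := 0) (by simp)).of_dist_le
    (K := 1) one_pos fun s hs t ht _ => ?_
  rw [uIcc_of_le S.T_pos.le] at hs ht
  rw [kalman_apply_eq hy k i hs, kalman_apply_eq hy k i ht]
  simp

theorem ae_hasDerivAt_kalman (hy : IntegrableOn y (Ioo 0 S.T)) (k : ι) :
    ∀ᵐ t, t ∈ Ioo 0 S.T → HasDerivAt (S.kalman y k) (S.kalmanRHS y k (S.kalman y k) t) t := by
  filter_upwards [(intervalIntegrable_kalmanRHS hy k).ae_hasDerivAt_integral] with t ht hmem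
  have h1 := (ht (by rw [uIcc_of_le S.T_pos.le]; exact Ioo_subset_Icc_self hmem) 0
    (by simp)).const_add S.x₀
  refine h1.congr_of_eventuallyEq ?_
  filter_upwards [Icc_mem_nhds hmem.1 hmem.2] with s hs
  exact kalman_eq hy k hs

theorem kalmanDeriv_eq_of_hasDerivWithinAt {k : ι} {t : ℝ} {v : Fin n → ℝ} (ht : t ∈ Icc 0 S.T)
    (h : HasDerivWithinAt (S.kalman y k) v (Icc 0 S.T) t) : S.kalmanDeriv y k t = v :=
  h.derivWithin (uniqueDiffOn_Icc S.T_pos t ht)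

end UncertainSystem

/-! ### The gradient of the entropic objective as a function of state and parameters. -/

namespace EntropicRisk

open scoped Matrix.Norms.Operator

variable {ι : Type*} {n : ℕ}

/-- Data of a family of quadratic energies `x ↦ ‖x - ξₖ‖²_{Pₖ} + ρₖ`: the triples
`(Pₖ, ξₖ, ρₖ)`. -/
abbrev Params (ι : Type*) (n : ℕ) : Type _ :=
  ι → Matrix (Fin n) (Fin n) ℝ × (Fin n → ℝ) × ℝ

/-- The exponential weights `exp (θ (‖x - ξₖ‖²_{Pₖ} + ρₖ))`. -/
noncomputable def weight (θ : ℝ) (q : Params ι n) (x : Fin n → ℝ) (k : ι) : ℝ :=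
  Real.exp (θ * (wnormSq (q k).1 (x - (q k).2.1) + (q k).2.2))

/-- Up to the factor `2 θ`, the gradient of the sum of the weights. -/
noncomputable def grad [Fintype ι] (θ : ℝ) (q : Params ι n) (x : Fin n → ℝ) : Fin n → ℝ :=
  ∑ k, weight θ q x k • ((q k).1 *ᵥ (x - (q k).2.1))

/-- The derivative of `grad` in the state. -/
noncomputable def hess [Fintype ι] (θ : ℝ) (q : Params ι n) (x : Fin n → ℝ) : Matrix (Fin n) (Fin n) ℝ :=
  ∑ k, weight θ q x k • ((q k).1 +
    (2 * θ) • ((q k).1 * vecMulVec (x - (q k).2.1) (x - (q k).2.1) * (q k).1))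

/-- The derivative of `grad` in the parameters, in the direction `q'`. -/
noncomputable def gradParam [Fintype ι] (θ : ℝ) (q q' : Params ι n) (x : Fin n → ℝ) : Fin n → ℝ :=
  - ∑ k, weight θ q x k • ((q k).1 *ᵥ (q' k).2.1 - (q' k).1 *ᵥ (x - (q k).2.1))
  + θ • ∑ k, (weight θ q x k * ((q' k).2.2
        - 2 * ((x - (q k).2.1) ⬝ᵥ ((q k).1 *ᵥ (q' k).2.1))
        + (x - (q k).2.1) ⬝ᵥ ((q' k).1 *ᵥ (x - (q k).2.1)))) •
      ((q k).1 *ᵥ (x - (q k).2.1))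

theorem weight_pos (θ : ℝ) (q : Params ι n) (x : Fin n → ℝ) (k : ι) : 0 < weight θ q x k :=
  Real.exp_pos _

theorem dotProduct_mulVec_comm_of_symm {P : Matrix (Fin n) (Fin n) ℝ} (hP : Pᵀ = P)
    (u v : Fin n → ℝ) : u ⬝ᵥ (P *ᵥ v) = v ⬝ᵥ (P *ᵥ u) := by
  rw [dotProduct_mulVec, ← mulVec_transpose, hP, dotProduct_comm]

theorem _root_.HasDerivWithinAt.matrix_mulVec {P : ℝ → Matrix (Fin n) (Fin n) ℝ}
    {P' : Matrix (Fin n) (Fin n) ℝ} {v : ℝ → Fin n → ℝ} {v' : Fin n → ℝ} {s : Set ℝ} {t : ℝ}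
    (hP : HasDerivWithinAt P P' s t) (hv : HasDerivWithinAt v v' s t) :
    HasDerivWithinAt (fun u => P u *ᵥ v u) (P' *ᵥ v t + P t *ᵥ v') s t := by
  rw [hasDerivWithinAt_pi]
  intro i
  convert! HasDerivWithinAt.fun_sum (u := Finset.univ) fun j _ =>
    (Matrix.hasDerivWithinAt_iff.1 hP i j).mul (hasDerivWithinAt_pi.1 hv j) using 1
  rw [Finset.sum_add_distrib]
  rfl

theorem _root_.HasDerivWithinAt.dotProduct {v w : ℝ → Fin n → ℝ} {v' w' : Fin n → ℝ} {s : Set ℝ}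
    {t : ℝ} (hv : HasDerivWithinAt v v' s t) (hw : HasDerivWithinAt w w' s t) :
    HasDerivWithinAt (fun u => v u ⬝ᵥ w u) (v' ⬝ᵥ w t + v t ⬝ᵥ w') s t := by
  convert! HasDerivWithinAt.fun_sum (u := Finset.univ) fun j _ =>
    (hasDerivWithinAt_pi.1 hv j).mul (hasDerivWithinAt_pi.1 hw j) using 1
  rw [Finset.sum_add_distrib]
  rfl

theorem hasDerivWithinAt_weight [Fintype ι] {θ : ℝ} {q : ℝ → Params ι n} {q' : Params ι n}
    {x : ℝ → Fin n → ℝ} {x' : Fin n → ℝ} {s : Set ℝ} {t : ℝ}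
    (hq : HasDerivWithinAt q q' s t) (hx : HasDerivWithinAt x x' s t) (k : ι)
    (hsymm : (q t k).1ᵀ = (q t k).1) :
    HasDerivWithinAt (fun u => weight θ (q u) (x u) k)
      (weight θ (q t) (x t) k * (θ * ((q' k).2.2
        - 2 * ((x t - (q t k).2.1) ⬝ᵥ ((q t k).1 *ᵥ (q' k).2.1))
        + 2 * ((x t - (q t k).2.1) ⬝ᵥ ((q t k).1 *ᵥ x'))
        + (x t - (q t k).2.1) ⬝ᵥ ((q' k).1 *ᵥ (x t - (q t k).2.1))))) s t := by
  have hqk := hasDerivWithinAt_pi.1 hq k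
  have hP : HasDerivWithinAt (fun u => (q u k).1) (q' k).1 s t := hqk.fst
  have hξ : HasDerivWithinAt (fun u => (q u k).2.1) (q' k).2.1 s t := hqk.snd.fst
  have hρ : HasDerivWithinAt (fun u => (q u k).2.2) (q' k).2.2 s t := hqk.snd.snd
  have hd := hx.fun_sub hξ
  convert! (((hd.dotProduct (hP.matrix_mulVec hd)).fun_add hρ).const_mul θ).exp using 1
  have e := dotProduct_mulVec_comm_of_symm hsymm (x' - (q' k).2.1) (x t - (q t k).2.1)
  rw [e]
  simp only [weight, wnormSq, dotProduct_add, mulVec_sub, dotProduct_sub]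
  ring

/-- Used twice: with frozen parameters it identifies the partial derivative needed for the implicit
function theorem, and along the trajectory it gives the formula for the derivative of the estimator.
-/
theorem hasDerivWithinAt_grad [Fintype ι] {θ : ℝ} {q : ℝ → Params ι n} {q' : Params ι n}
    {x : ℝ → Fin n → ℝ} {x' : Fin n → ℝ} {s : Set ℝ} {t : ℝ}
    (hq : HasDerivWithinAt q q' s t) (hx : HasDerivWithinAt x x' s t)
    (hsymm : ∀ k, (q t k).1ᵀ = (q t k).1) :
    HasDerivWithinAt (fun u => grad θ (q u) (x u))
      (hess θ (q t) (x t) *ᵥ x' + gradParam θ (q t) q' (x t)) s t := by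
  have hterm : ∀ k, HasDerivWithinAt
      (fun u => weight θ (q u) (x u) k • ((q u k).1 *ᵥ (x u - (q u k).2.1))) _ s t := fun k =>
    (hasDerivWithinAt_weight hq hx k (hsymm k)).smul
      (HasDerivWithinAt.matrix_mulVec (P := fun u => (q u k).1)
        (hasDerivWithinAt_pi.1 hq k).fst
        (hx.fun_sub (f := x) (hasDerivWithinAt_pi.1 hq k).snd.fst))
  convert! HasDerivWithinAt.fun_sum (u := Finset.univ) fun k _ => hterm k using 1
  simp only [hess, gradParam, Matrix.sum_mulVec, Finset.smul_sum, ← Finset.sum_neg_distrib,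
    ← Finset.sum_add_distrib]
  refine Finset.sum_congr rfl fun k _ => ?_
  have e : ∀ d : Fin n → ℝ, ((q t k).1 * vecMulVec d d * (q t k).1) *ᵥ x' =
      (d ⬝ᵥ ((q t k).1 *ᵥ x')) • ((q t k).1 *ᵥ d) := by
    intro d
    rw [← mulVec_mulVec, ← mulVec_mulVec, vecMulVec_mulVec, ← mulVec_smul]
    simp
  simp only [smul_mulVec, add_mulVec, e, mulVec_sub]
  ext i
  simp only [Pi.add_apply, Pi.smul_apply, Pi.neg_apply, Pi.sub_apply, smul_eq_mul]
  ring

/-- Splits the monotonicity pairing into two terms: the first is positive for `α, β > 0` and `u ≠ w`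
when `P` is positive definite, the second is nonnegative once `α - β` has the sign of the difference
of the norms. -/
theorem wnormSq_smul_sub {P : Matrix (Fin n) (Fin n) ℝ} (hP : Pᵀ = P) (α β : ℝ)
    (u w : Fin n → ℝ) :
    (u - w) ⬝ᵥ (α • (P *ᵥ u) - β • (P *ᵥ w)) =
      (α + β) / 2 * wnormSq P (u - w) + (α - β) / 2 * (wnormSq P u - wnormSq P w) := by
  have e := dotProduct_mulVec_comm_of_symm hP u w
  simp only [wnormSq, dotProduct_sub, sub_dotProduct, dotProduct_smul, mulVec_sub, smul_eq_mul, e]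
  ring

/-- Strict monotonicity of the gradient of the entropic risk. -/
theorem grad_strictMono [Fintype ι] [Nonempty ι] {θ : ℝ} (hθ : 0 < θ) {q : Params ι n}
    (hq : ∀ k, (q k).1.PosDef) {x z : Fin n → ℝ} (hxz : x ≠ z) :
    0 < (x - z) ⬝ᵥ (grad θ q x - grad θ q z) := by
  simp only [grad, ← Finset.sum_sub_distrib, dotProduct_sum]
  refine Finset.sum_pos (fun k _ => ?_) Finset.univ_nonempty
  have hs : (q k).1ᵀ = (q k).1 := by simpa using (hq k).isHermitian.eq
  have e := wnormSq_smul_sub hs (weight θ q x k) (weight θ q z k) (x - (q k).2.1) (z - (q k).2.1)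
  rw [sub_sub_sub_cancel_right] at e
  rw [e]
  have h1 : 0 < wnormSq (q k).1 (x - z) := by
    simpa [wnormSq] using (hq k).dotProduct_mulVec_pos (sub_ne_zero.2 hxz)
  -- The weight is an increasing function of the norm, since `θ > 0`; both factors have the same
  -- sign.
  have h2 : 0 ≤ (weight θ q x k - weight θ q z k) / 2 *
      (wnormSq (q k).1 (x - (q k).2.1) - wnormSq (q k).1 (z - (q k).2.1)) := by
    rcases le_total (wnormSq (q k).1 (x - (q k).2.1)) (wnormSq (q k).1 (z - (q k).2.1)) with h | h
    · have : weight θ q x k ≤ weight θ q z k := by unfold weight; gcongr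
      exact mul_nonneg_of_nonpos_of_nonpos (by linarith) (by linarith)
    · have : weight θ q z k ≤ weight θ q x k := by unfold weight; gcongr
      exact mul_nonneg (by linarith) (by linarith)
  have h3 := weight_pos θ q x k
  have h4 := weight_pos θ q z k
  positivity

theorem grad_zero_unique [Fintype ι] [Nonempty ι] {θ : ℝ} (hθ : 0 < θ) {q : Params ι n}
    (hq : ∀ k, (q k).1.PosDef) {x z : Fin n → ℝ} (hx : grad θ q x = 0) (hz : grad θ q z = 0) :
    x = z := by
  by_contra h
  have := grad_strictMono hθ hq h
  simp [hx, hz] at this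

/-- With `d = x - ξ_k`, each summand is the weight times `vᵀPv + 2θ (dᵀPv)²`. -/
theorem hess_dotProduct_pos [Fintype ι] [Nonempty ι] {θ : ℝ} (hθ : 0 < θ) {q : Params ι n}
    (hq : ∀ k, (q k).1.PosDef) (x : Fin n → ℝ) {v : Fin n → ℝ} (hv : v ≠ 0) :
    0 < v ⬝ᵥ (hess θ q x *ᵥ v) := by
  simp only [hess, Matrix.sum_mulVec, dotProduct_sum]
  refine Finset.sum_pos (fun k _ => ?_) Finset.univ_nonempty
  have hs : (q k).1ᵀ = (q k).1 := by simpa using (hq k).isHermitian.eq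
  have h1 : 0 < v ⬝ᵥ ((q k).1 *ᵥ v) := by simpa using (hq k).dotProduct_mulVec_pos hv
  set d := x - (q k).2.1
  have e : ((q k).1 * vecMulVec d d * (q k).1) *ᵥ v =
      (d ⬝ᵥ ((q k).1 *ᵥ v)) • ((q k).1 *ᵥ d) := by
    rw [← mulVec_mulVec, ← mulVec_mulVec, vecMulVec_mulVec, ← mulVec_smul]
    simp
  simp only [smul_mulVec, add_mulVec, e, dotProduct_smul, dotProduct_add, smul_eq_mul,
    dotProduct_mulVec_comm_of_symm hs v d]
  have h3 := weight_pos θ q x k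
  have := mul_self_nonneg (d ⬝ᵥ ((q k).1 *ᵥ v))
  positivity

theorem hess_isUnit [Fintype ι] [Nonempty ι] {θ : ℝ} (hθ : 0 < θ) {q : Params ι n}
    (hq : ∀ k, (q k).1.PosDef) (x : Fin n → ℝ) : IsUnit (hess θ q x) := by
  rw [← Matrix.mulVec_injective_iff_isUnit]
  refine (injective_iff_map_eq_zero (Matrix.mulVecLin (hess θ q x))).2 fun v hv => ?_
  by_contra h
  have := hess_dotProduct_pos hθ hq x h
  rw [Matrix.mulVecLin_apply] at hv
  simp [hv] at this

theorem contDiff_grad [Fintype ι] (θ : ℝ) :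
    ContDiff ℝ 1 (fun p : Params ι n × (Fin n → ℝ) => grad θ p.1 p.2) := by
  have hP : ∀ (k : ι) (i j : Fin n),
      ContDiff ℝ 1 (fun p : Params ι n × (Fin n → ℝ) => (p.1 k).1 i j) := fun k i j =>
    (Matrix.entryCLM i j).contDiff.comp (contDiff_fst.comp
      ((ContinuousLinearMap.proj (R := ℝ)
        (φ := fun _ : ι => Matrix (Fin n) (Fin n) ℝ × (Fin n → ℝ) × ℝ) k).contDiff.comp
          contDiff_fst))
  have hd : ∀ (k : ι) (i : Fin n),
      ContDiff ℝ 1 (fun p : Params ι n × (Fin n → ℝ) => (p.2 - (p.1 k).2.1) i) := fun k i => by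
    simp only [Pi.sub_apply]
    fun_prop
  have hPd : ∀ (k : ι) (i : Fin n), ContDiff ℝ 1
      (fun p : Params ι n × (Fin n → ℝ) => ((p.1 k).1 *ᵥ (p.2 - (p.1 k).2.1)) i) := fun k i =>
    ContDiff.sum (s := Finset.univ) fun j _ => (hP k i j).mul (hd k j)
  have hw : ∀ k : ι, ContDiff ℝ 1
      (fun p : Params ι n × (Fin n → ℝ) => weight θ p.1 p.2 k) := fun k => by
    have h1 : ContDiff ℝ 1 (fun p : Params ι n × (Fin n → ℝ) =>
        wnormSq (p.1 k).1 (p.2 - (p.1 k).2.1)) :=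
      ContDiff.sum (s := Finset.univ) fun j _ => (hd k j).mul (hPd k j)
    have h2 : ContDiff ℝ 1 (fun p : Params ι n × (Fin n → ℝ) => (p.1 k).2.2) := by fun_prop
    exact (contDiff_const.mul (h1.add h2)).exp
  refine ContDiff.sum fun k _ => contDiff_pi.2 fun i => ?_
  exact (hw k).mul (hPd k i)

/-- Near a nondegenerate zero, the zeros of `grad` are a differentiable and locally Lipschitz
function of the parameters. -/
theorem exists_local_solution [Fintype ι] [Nonempty ι] {θ : ℝ} (hθ : 0 < θ) {q₀ : Params ι n}
    (hq₀ : ∀ k, (q₀ k).1.PosDef) {x₀ : Fin n → ℝ} (h₀ : grad θ q₀ x₀ = 0) :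
    ∃ ψ : Params ι n → Fin n → ℝ, DifferentiableAt ℝ ψ q₀ ∧
      (∃ K, ∃ U ∈ nhds q₀, LipschitzOnWith K ψ U) ∧ ∀ᶠ q in nhds q₀, grad θ q (ψ q) = 0 := by
  have hstrict := (contDiff_grad (ι := ι) (n := n) θ).contDiffAt.hasStrictFDerivAt
    (x := (q₀, x₀)) (by norm_num)
  set D := fderiv ℝ (fun p : Params ι n × (Fin n → ℝ) => grad θ p.1 p.2) (q₀, x₀)
  -- The partial derivative in `x` is read off along the lines `t ↦ (q₀, x₀ + t v)`.
  have hD : ∀ v, (D ∘L .inr ℝ (Params ι n) (Fin n → ℝ)) v = hess θ q₀ x₀ *ᵥ v := by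
    intro v
    have hx : HasDerivAt (fun t : ℝ => x₀ + t • v) v 0 := by
      simpa using ((hasDerivAt_id (0 : ℝ)).smul_const v).const_add x₀
    have hline : HasDerivAt (fun t : ℝ => (q₀, x₀ + t • v)) (0, v) 0 :=
      (hasDerivAt_const (0 : ℝ) q₀).prodMk hx
    have hstrict' : HasFDerivAt (fun p : Params ι n × (Fin n → ℝ) => grad θ p.1 p.2) D
        ((fun t : ℝ => (q₀, x₀ + t • v)) 0) := by
      have e : (fun t : ℝ => (q₀, x₀ + t • v)) 0 = (q₀, x₀) := by simp
      rw [e]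
      exact hstrict.hasFDerivAt
    have h1 := hstrict'.comp_hasDerivAt (0 : ℝ) hline
    have h2 := hasDerivWithinAt_grad (θ := θ) (hasDerivWithinAt_const (0 : ℝ) univ q₀)
      hx.hasDerivWithinAt (s := univ) fun k => by simpa using (hq₀ k).isHermitian.eq
    have h3 := h1.unique (hasDerivWithinAt_univ.1 h2)
    simpa [gradParam] using! h3
  have hinj : Function.Injective (D ∘L .inr ℝ (Params ι n) (Fin n → ℝ)) := by
    intro v w hvw
    rw [hD, hD] at hvw
    exact (Matrix.mulVec_injective_iff_isUnit.2 (hess_isUnit hθ hq₀ x₀)) hvw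
  have hinv : (D ∘L .inr ℝ (Params ι n) (Fin n → ℝ)).IsInvertible := by
    let e := (LinearEquiv.ofInjectiveEndo
      (D ∘L .inr ℝ (Params ι n) (Fin n → ℝ)).toLinearMap hinj).toContinuousLinearEquiv
    exact ⟨e, by ext1 v; rfl⟩
  have hψ := hstrict.hasStrictFDerivAt_implicitFunctionOfProdDomain hinv
  -- Strict differentiability at the single point `q₀` already gives a Lipschitz bound on a
  -- neighbourhood.
  refine ⟨hstrict.implicitFunctionOfProdDomain hinv, hψ.hasFDerivAt.differentiableAt,
    hψ.exists_lipschitzOnWith, ?_⟩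
  filter_upwards [hstrict.eventually_apply_implicitFunctionOfProdDomain hinv] with q hq
  exact hq.trans h₀

end EntropicRisk

/-! ### Coercivity and existence of minimizers. -/

theorem continuous_wnormSq {d : ℕ} (M : Matrix (Fin d) (Fin d) ℝ) : Continuous (wnormSq M) :=
  continuous_id.dotProduct (continuous_const.matrix_mulVec continuous_id)

theorem wnormSq_smul {d : ℕ} (M : Matrix (Fin d) (Fin d) ℝ) (c : ℝ) (x : Fin d → ℝ) :
    wnormSq M (c • x) = c ^ 2 * wnormSq M x := by
  simp only [wnormSq, mulVec_smul, smul_dotProduct, dotProduct_smul, smul_eq_mul]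
  ring

theorem Matrix.PosDef.exists_le_wnormSq {d : ℕ} {M : Matrix (Fin d) (Fin d) ℝ} (hM : M.PosDef) :
    ∃ c > 0, ∀ x, c * ‖x‖ ^ 2 ≤ wnormSq M x := by
  -- The unit sphere is empty when `d = 0`. Otherwise the constant is the minimum of the form on the
  -- sphere, extended by homogeneity.
  rcases (Metric.sphere (0 : Fin d → ℝ) 1).eq_empty_or_nonempty with h | h
  · refine ⟨1, one_pos, fun x => ?_⟩
    have hx : x = 0 := by
      by_contra hx
      have : ‖x‖⁻¹ • x ∈ Metric.sphere (0 : Fin d → ℝ) 1 := by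
        simp [norm_smul, norm_ne_zero_iff.2 hx]
      rw [h] at this
      exact this
    simp [hx, wnormSq]
  · obtain ⟨e, he, hmin⟩ := (isCompact_sphere (0 : Fin d → ℝ) 1).exists_isMinOn h
      (continuous_wnormSq M).continuousOn
    have he0 : e ≠ 0 := by
      rintro rfl
      simp at he
    refine ⟨wnormSq M e, by simpa [wnormSq] using hM.dotProduct_mulVec_pos he0, fun x => ?_⟩
    rcases eq_or_ne x 0 with rfl | hx
    · simp [wnormSq]
    have hx' : ‖x‖ ≠ 0 := norm_ne_zero_iff.2 hx
    have h1 : ‖x‖⁻¹ • x ∈ Metric.sphere (0 : Fin d → ℝ) 1 := by simp [norm_smul, hx']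
    have h2 : wnormSq M e ≤ wnormSq M (‖x‖⁻¹ • x) := hmin h1
    rw [wnormSq_smul] at h2
    calc wnormSq M e * ‖x‖ ^ 2 ≤ (‖x‖⁻¹ ^ 2 * wnormSq M x) * ‖x‖ ^ 2 := by gcongr
      _ = wnormSq M x := by field_simp

namespace EntropicRisk

open scoped Matrix.Norms.Operator
open Filter

variable {ι : Type*} {n : ℕ} {θ : ℝ}

theorem continuous_weight (q : Params ι n) (k : ι) : Continuous fun x => weight θ q x k :=
  Real.continuous_exp.comp (continuous_const.mul
    (((continuous_wnormSq _).comp (continuous_id.sub continuous_const)).add continuous_const))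

variable [Fintype ι]

/-- Moving from `x` along `v = grad θ q x`, the sum of the weights has derivative `2θ (v ⬝ᵥ v)` at
`0`, which vanishes at a minimum. -/
theorem grad_eq_zero_of_min (hθ : 0 < θ) {q : Params ι n} (hq : ∀ k, (q k).1.PosDef)
    {x : Fin n → ℝ} (hx : ∀ z, ∑ k, weight θ q x k ≤ ∑ k, weight θ q z k) :
    grad θ q x = 0 := by
  set v := grad θ q x with hv
  have hline : HasDerivAt (fun t : ℝ => x + t • v) v 0 := by
    simpa using ((hasDerivAt_id (0 : ℝ)).smul_const v).const_add x
  have hder := HasDerivWithinAt.fun_sum (u := Finset.univ) fun k _ =>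
    hasDerivWithinAt_weight (θ := θ) (hasDerivWithinAt_const (0 : ℝ) univ q)
      (hline.hasDerivWithinAt (s := univ)) k (by simpa using (hq k).isHermitian.eq)
  have hmin : IsLocalMin (fun t : ℝ => ∑ k, weight θ q (x + t • v) k) 0 :=
    Filter.Eventually.of_forall fun t => by simpa using hx (x + t • v)
  have h0 := hmin.hasDerivAt_eq_zero (hasDerivWithinAt_univ.1 hder)
  have e : ∀ k, (x - (q k).2.1) ⬝ᵥ ((q k).1 *ᵥ v) = v ⬝ᵥ ((q k).1 *ᵥ (x - (q k).2.1)) := fun k =>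
    dotProduct_mulVec_comm_of_symm (by simpa using (hq k).isHermitian.eq) _ _
  have h1 : 2 * θ * (v ⬝ᵥ v) = 0 := by
    have hvv : v ⬝ᵥ v = ∑ k, v ⬝ᵥ (weight θ q x k • ((q k).1 *ᵥ (x - (q k).2.1))) := by
      conv_lhs => rw [hv]
      rw [grad, ← dotProduct_sum, ← grad]
    rw [← h0, hvv, Finset.mul_sum]
    refine Finset.sum_congr rfl fun k _ => ?_
    simp [e, dotProduct_smul]
    ring
  have h2 : v ⬝ᵥ v = 0 := by
    rcases mul_eq_zero.1 h1 with h | h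
    · linarith
    · exact h
  exact dotProduct_self_eq_zero.1 h2

variable [Nonempty ι]

theorem entropicRisk_le_iff (hθ : 0 < θ) {E F : ι → ℝ} :
    entropicRisk θ E ≤ entropicRisk θ F ↔
      ∑ k, Real.exp (θ * E k) ≤ ∑ k, Real.exp (θ * F k) := by
  have hc : (0 : ℝ) < Fintype.card ι := by exact_mod_cast Fintype.card_pos
  have hpos : ∀ X : ι → ℝ, 0 < (1 / (Fintype.card ι : ℝ)) * ∑ k, Real.exp (θ * X k) := fun X =>
    mul_pos (by positivity) (Finset.sum_pos (fun k _ => Real.exp_pos _) Finset.univ_nonempty)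
  unfold entropicRisk
  rw [mul_le_mul_iff_right₀ (by positivity), Real.log_le_log_iff (hpos E) (hpos F),
    mul_le_mul_iff_right₀ (by positivity)]

/-- One summand is enough for coercivity: `exp s ≥ s + 1`, and the exponent grows quadratically. -/
theorem exists_min_sum_weight (hθ : 0 < θ) {q : Params ι n} (hq : ∀ k, (q k).1.PosDef) :
    ∃ x, ∀ z, ∑ k, weight θ q x k ≤ ∑ k, weight θ q z k := by
  refine (continuous_finsetSum _ fun k _ => continuous_weight q k).exists_forall_le ?_
  obtain ⟨k⟩ := ‹Nonempty ι›
  obtain ⟨c, hc, hle⟩ := (hq k).exists_le_wnormSq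
  have h1 : Tendsto (fun x : Fin n → ℝ => ‖x‖ - ‖(q k).2.1‖) (cocompact _) atTop :=
    tendsto_atTop_add_const_right _ _ tendsto_norm_cocompact_atTop
  have h2 : Tendsto (fun x : Fin n → ℝ => ‖x - (q k).2.1‖) (cocompact _) atTop :=
    tendsto_atTop_mono (fun x => norm_sub_norm_le _ _) h1
  have h3 : Tendsto (fun x : Fin n → ℝ => θ * (c * ‖x - (q k).2.1‖ ^ 2 + (q k).2.2))
      (cocompact _) atTop :=
    (tendsto_atTop_add_const_right _ _
      (((tendsto_pow_atTop two_ne_zero).comp h2).const_mul_atTop hc)).const_mul_atTop hθ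
  refine tendsto_atTop_mono (fun x => ?_) h3
  calc θ * (c * ‖x - (q k).2.1‖ ^ 2 + (q k).2.2)
      ≤ θ * (wnormSq (q k).1 (x - (q k).2.1) + (q k).2.2) := by gcongr; exact hle _
    _ ≤ weight θ q x k := (lt_add_one _).le.trans (Real.add_one_le_exp _)
    _ ≤ ∑ k, weight θ q x k :=
      Finset.single_le_sum (fun k _ => (weight_pos θ q x k).le) (Finset.mem_univ k)

end EntropicRisk

/-! ### The estimator as a function of the parameters. -/

namespace UncertainSystem

open EntropicRisk
open scoped Matrix.Norms.Operator

variable {ι : Type*} {n m r : ℕ} (S : UncertainSystem ι n m r)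

/-- The parameters `(Pₖ(t), x̂ₖ(t), rₖ(t))` of the energies at time `t`. -/
noncomputable def params (y : ℝ → Fin r → ℝ) (t : ℝ) : Params ι n :=
  fun k => (S.precision k t, S.kalman y k t, S.residual y k t)

/-- The time derivative of the parameters, in terms of the Kalman filter equation. -/
noncomputable def paramsDeriv (y : ℝ → Fin r → ℝ) (t : ℝ) : Params ι n :=
  fun k => (S.precisionDeriv k t, S.kalmanRHS y k (S.kalman y k) t,
    wnormSq (S.Q k)⁻¹ (y t - S.C *ᵥ S.kalman y k t))

variable {S} {y : ℝ → Fin r → ℝ} {θ : ℝ}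

theorem params_posDef {t : ℝ} (ht : t ∈ Icc 0 S.T) (k : ι) : (S.params y t k).1.PosDef :=
  S.precision_posDef k ht

variable [Fintype ι]

theorem grad_estimator [Nonempty ι] (hθ : 0 < θ) {t : ℝ} (ht : t ∈ Icc 0 S.T) :
    grad θ (S.params y t) (S.estimator θ y t) = 0 := by
  have hiff : ∀ x, IsMinOn (fun z => entropicRisk θ fun k => S.energy y k t z) univ x ↔
      ∀ z, ∑ k, weight θ (S.params y t) x k ≤ ∑ k, weight θ (S.params y t) z k := by
    intro x
    simp only [isMinOn_iff, mem_univ, true_imp_iff, entropicRisk_le_iff hθ]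
    rfl
  refine grad_eq_zero_of_min hθ (params_posDef ht) ((hiff _).1 ?_)
  obtain ⟨x, hx⟩ := exists_min_sum_weight hθ (params_posDef (S := S) (y := y) ht)
  exact Classical.epsilon_spec (p := fun x : Fin n → ℝ =>
    IsMinOn (fun z => entropicRisk θ fun k => S.energy y k t z) univ x) ⟨x, (hiff x).2 hx⟩

theorem matM_eq_hess (t : ℝ) (x : Fin n → ℝ) : S.matM θ y t x = hess θ (S.params y t) x := rfl

theorem isUnit_matM [Nonempty ι] (hθ : 0 < θ) {t : ℝ} (ht : t ∈ Icc 0 S.T) (x : Fin n → ℝ) :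
    IsUnit (S.matM θ y t x) :=
  hess_isUnit hθ (params_posDef ht) x

/-- The estimator is, near every time, a differentiable and Lipschitz function of the
parameters. -/
theorem exists_local_estimator [Nonempty ι] (hθ : 0 < θ)
    (hc : ContinuousOn (S.params y) (Icc 0 S.T)) {t : ℝ} (ht : t ∈ Icc 0 S.T) :
    ∃ ψ : Params ι n → Fin n → ℝ, DifferentiableAt ℝ ψ (S.params y t) ∧
      (∃ K, ∃ U ∈ nhds (S.params y t), LipschitzOnWith K ψ U) ∧
      ∀ᶠ s in nhdsWithin t (Icc 0 S.T), S.estimator θ y s = ψ (S.params y s) := by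
  obtain ⟨ψ, hd, hL, hz⟩ := exists_local_solution hθ (params_posDef (S := S) (y := y) ht)
    (grad_estimator hθ ht)
  refine ⟨ψ, hd, hL, ?_⟩
  -- Near `t` both `ψ (params s)` and the estimator are zeros of the same `grad`, so uniqueness
  -- identifies them.
  filter_upwards [(hc t ht).eventually hz, self_mem_nhdsWithin] with s hs hmem
  exact grad_zero_unique hθ (params_posDef hmem) (grad_estimator hθ hmem) hs

theorem continuousOn_estimator [Nonempty ι] (hθ : 0 < θ)
    (hc : ContinuousOn (S.params y) (Icc 0 S.T)) :
    ContinuousOn (S.estimator θ y) (Icc 0 S.T) := by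
  intro t ht
  obtain ⟨ψ, hd, -, he⟩ := exists_local_estimator hθ hc ht
  exact (hd.continuousAt.comp_continuousWithinAt (hc t ht)).congr_of_eventuallyEq he
    (he.self_of_nhdsWithin ht)

/-- `vecV` uses `derivWithin` of the filter, `paramsDeriv` the right-hand side of its equation; they
agree where `params` is differentiable. -/
theorem vecV_eq_gradParam {t : ℝ} (ht : t ∈ Icc 0 S.T)
    (hd : HasDerivWithinAt (S.params y) (S.paramsDeriv y t) (Icc 0 S.T) t) (x : Fin n → ℝ) :
    S.vecV θ y t x = gradParam θ (S.params y t) (S.paramsDeriv y t) x := by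
  have hk : ∀ k, S.kalmanDeriv y k t = S.kalmanRHS y k (S.kalman y k) t := fun k =>
    kalmanDeriv_eq_of_hasDerivWithinAt ht (hasDerivWithinAt_pi.1 hd k).snd.fst
  simp only [vecV, hk]
  rfl

theorem hasDerivWithinAt_estimator [Nonempty ι] (hθ : 0 < θ)
    (hc : ContinuousOn (S.params y) (Icc 0 S.T)) {t : ℝ} (ht : t ∈ Icc 0 S.T)
    (hd : HasDerivWithinAt (S.params y) (S.paramsDeriv y t) (Icc 0 S.T) t) :
    HasDerivWithinAt (S.estimator θ y) (S.estimatorDeriv θ y t) (Icc 0 S.T) t := by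
  obtain ⟨ψ, hψ, -, he⟩ := exists_local_estimator hθ hc ht
  -- The implicit function supplies only the existence of a derivative; its value comes from
  -- differentiating `grad = 0`.
  obtain ⟨x', hx⟩ : ∃ x', HasDerivWithinAt (S.estimator θ y) x' (Icc 0 S.T) t :=
    ⟨_, (hψ.hasFDerivAt.comp_hasDerivWithinAt t hd).congr_of_eventuallyEq he
      (he.self_of_nhdsWithin ht)⟩
  have hg := hasDerivWithinAt_grad (θ := θ) hd hx fun k => by
    simpa using (params_posDef (S := S) (y := y) ht k).isHermitian.eq
  have h0 : HasDerivWithinAt (fun u => grad θ (S.params y u) (S.estimator θ y u)) 0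
      (Icc 0 S.T) t :=
    (hasDerivWithinAt_const t (Icc 0 S.T) (0 : Fin n → ℝ)).congr
      (fun s hs => grad_estimator hθ hs) (grad_estimator hθ ht)
  have huniq := (uniqueDiffOn_Icc S.T_pos t ht).eq_deriv _ hg h0
  have hM := (Matrix.isUnit_iff_isUnit_det _).1
    (isUnit_matM (S := S) (y := y) hθ ht (S.estimator θ y t))
  have hx' : x' = S.estimatorDeriv θ y t := by
    rw [estimatorDeriv, vecV_eq_gradParam ht hd, eq_neg_of_add_eq_zero_right huniq, ← matM_eq_hess, mulVec_neg, neg_neg, mulVec_mulVec, Matrix.nonsing_inv_mul _ hM, one_mulVec]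
  rw [← hx']
  exact hx

end UncertainSystem

open scoped Matrix.Norms.Operator in
theorem ContinuousOn.matrix_inv {n : ℕ} {M : ℝ → Matrix (Fin n) (Fin n) ℝ} {s : Set ℝ}
    (hM : ContinuousOn M s) (hu : ∀ t ∈ s, IsUnit (M t)) : ContinuousOn (fun t => (M t)⁻¹) s := by
  intro t ht
  obtain ⟨u, hu⟩ := hu t ht
  have h := NormedRing.inverse_continuousAt u
  rw [hu] at h
  simp only [Matrix.nonsing_inv_eq_ringInverse]
  exact h.comp_continuousWithinAt (hM t ht)

/-! ### Integrability of quadratic expressions, and calculus on the closed interval. -/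

section Lebesgue

theorem ContinuousOn.memLp_Ioo {E : Type*} [NormedAddCommGroup E] {f : ℝ → E} {a b : ℝ}
    (hf : ContinuousOn f (Icc a b)) (p : ℝ≥0∞) : MemLp f p (volume.restrict (Ioo a b)) := by
  obtain ⟨K, hK⟩ := isCompact_Icc.exists_bound_of_continuousOn hf
  refine MemLp.of_bound (hf.aestronglyMeasurable_of_subset_isCompact isCompact_Icc
    measurableSet_Ioo Ioo_subset_Icc_self) K ?_
  rw [ae_restrict_iff' measurableSet_Ioo]
  exact Filter.Eventually.of_forall fun t ht => hK t (Ioo_subset_Icc_self ht)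

theorem MeasureTheory.MemLp.matrix_mulVec {a b : ℕ} {T : ℝ} {p : ℝ≥0∞}
    {L : ℝ → Matrix (Fin a) (Fin b) ℝ} {w : ℝ → Fin b → ℝ}
    (hw : MemLp w p (volume.restrict (Ioo 0 T))) (hL : ContinuousOn L (Icc 0 T)) :
    MemLp (fun s => L s *ᵥ w s) p (volume.restrict (Ioo 0 T)) := by
  refine memLp_pi_iff.2 fun i => ?_
  change MemLp (fun s => ∑ j, L s i j * w s j) p _
  exact memLp_finsetSum _ fun j _ =>
    (memLp_pi_iff.1 hw j).mul' ((hL.matrix_elem i j).memLp_Ioo ∞)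

/-- Hölder: a quadratic form halves the exponent, whence the assumption `y ∈ L^{2p}`. -/
theorem MeasureTheory.MemLp.wnormSq {d : ℕ} {T : ℝ} {p q : ℝ≥0∞} [ENNReal.HolderTriple q q p]
    {w : ℝ → Fin d → ℝ} (hw : MemLp w q (volume.restrict (Ioo 0 T)))
    (M : Matrix (Fin d) (Fin d) ℝ) :
    MemLp (fun s => wnormSq M (w s)) p (volume.restrict (Ioo 0 T)) := by
  have h := hw.matrix_mulVec (L := fun _ => M) continuousOn_const
  change MemLp (fun s => ∑ i, w s i * (M *ᵥ w s) i) p _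
  exact memLp_finsetSum _ fun i _ => (memLp_pi_iff.1 h i).mul' (memLp_pi_iff.1 hw i)

theorem holderTriple_two_mul (p : ℝ≥0∞) : ENNReal.HolderTriple (2 * p) (2 * p) p := by
  refine ⟨?_⟩
  rw [ENNReal.mul_inv (Or.inl (by norm_num)) (Or.inl (by norm_num)), ← add_mul,
    ENNReal.inv_two_add_inv_two, one_mul]

end Lebesgue

theorem hasDerivWithinAt_integral_of_continuousOn {E : Type*} [NormedAddCommGroup E]
    [NormedSpace ℝ E] [CompleteSpace E] {f : ℝ → E} {T t : ℝ} (hf : ContinuousOn f (Icc 0 T))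
    (ht : t ∈ Icc 0 T) : HasDerivWithinAt (fun u => ∫ s in (0 : ℝ)..u, f s) (f t) (Icc 0 T) t := by
  -- This instance selects the version of the fundamental theorem of calculus relative to `Icc`,
  -- valid at the end points too.
  have : Fact (t ∈ Icc 0 T) := ⟨ht⟩
  refine intervalIntegral.integral_hasDerivWithinAt_right ?_ (t := Icc 0 T) ?_ (hf t ht)
  · refine (hf.mono ?_).intervalIntegrable
    rw [uIcc_of_le ht.1]
    exact Icc_subset_Icc_right ht.2
  · exact hf.stronglyMeasurableAtFilter_nhdsWithin measurableSet_Icc t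

/-- A bound on increments passes to derivatives. -/
theorem HasDerivAt.norm_le_of_dist_le {E F : Type*} [NormedAddCommGroup E] [NormedSpace ℝ E]
    [NormedAddCommGroup F] [NormedSpace ℝ F] {f : ℝ → E} {g : ℝ → F} {f' : E} {g' : F} {t K : ℝ}
    (hf : HasDerivAt f f' t) (hg : HasDerivAt g g' t)
    (h : ∀ᶠ s in nhds t, dist (f s) (f t) ≤ K * dist (g s) (g t)) : ‖f'‖ ≤ K * ‖g'‖ := by
  refine le_of_tendsto_of_tendsto hf.tendsto_slope.norm (hg.tendsto_slope.norm.const_mul K) ?_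
  filter_upwards [h.filter_mono nhdsWithin_le_nhds] with s hs
  rw [dist_eq_norm, dist_eq_norm] at hs
  simp only [slope_def_module, norm_smul]
  calc ‖(s - t)⁻¹‖ * ‖f s - f t‖ ≤ ‖(s - t)⁻¹‖ * (K * ‖g s - g t‖) := by gcongr
    _ = K * (‖(s - t)⁻¹‖ * ‖g s - g t‖) := by ring

/-! ### Regularity of the parameters and Sobolev regularity of the estimator. -/

namespace UncertainSystem

open EntropicRisk
open scoped Matrix.Norms.Operator

variable {ι : Type*} {n m r : ℕ} {S : UncertainSystem ι n m r} {y : ℝ → Fin r → ℝ} {θ : ℝ}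

theorem memLp_innovation {q : ℝ≥0∞} (hy : MemLp y q (volume.restrict (Ioo 0 S.T)))
    (hyi : IntegrableOn y (Ioo 0 S.T)) (k : ι) :
    MemLp (fun s => y s - S.C *ᵥ S.kalman y k s) q (volume.restrict (Ioo 0 S.T)) :=
  hy.sub ((continuousOn_const.matrix_mulVec (continuousOn_kalman hyi k)).memLp_Ioo q)

theorem memLp_kalmanRHS {q : ℝ≥0∞} (hy : MemLp y q (volume.restrict (Ioo 0 S.T)))
    (hyi : IntegrableOn y (Ioo 0 S.T)) (k : ι) :
    MemLp (S.kalmanRHS y k (S.kalman y k)) q (volume.restrict (Ioo 0 S.T)) :=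
  ((continuousOn_const.matrix_mulVec (continuousOn_kalman hyi k)).memLp_Ioo q).add
    ((memLp_innovation hy hyi k).matrix_mulVec (S.continuousOn_gain k))

theorem integrableOn_of_memLp_two (hy : MemLp y 2 (volume.restrict (Ioo 0 S.T))) :
    IntegrableOn y (Ioo 0 S.T) :=
  hy.integrable (by norm_num)

theorem intervalIntegrable_residual (hy : MemLp y 2 (volume.restrict (Ioo 0 S.T))) (k : ι) :
    IntervalIntegrable (fun s => wnormSq (S.Q k)⁻¹ (y s - S.C *ᵥ S.kalman y k s))
      volume 0 S.T := by
  rw [intervalIntegrable_iff_integrableOn_Ioo_of_le S.T_pos.le]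
  have h : ENNReal.HolderTriple 2 2 1 := by simpa using holderTriple_two_mul 1
  exact memLp_one_iff_integrable.1
    ((memLp_innovation hy (integrableOn_of_memLp_two hy) k).wnormSq _)

theorem continuousOn_kalmanRHS (hy : ContinuousOn y (Icc 0 S.T)) (k : ι) {x : ℝ → Fin n → ℝ}
    (hx : ContinuousOn x (Icc 0 S.T)) : ContinuousOn (S.kalmanRHS y k x) (Icc 0 S.T) :=
  (continuousOn_const.matrix_mulVec hx).add
    ((S.continuousOn_gain k).matrix_mulVec (hy.sub (continuousOn_const.matrix_mulVec hx)))

theorem continuousOn_paramsDeriv (hy : ContinuousOn y (Icc 0 S.T)) :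
    ContinuousOn (S.paramsDeriv y) (Icc 0 S.T) := by
  have hyi := integrableOn_of_memLp_two (hy.memLp_Ioo 2)
  refine continuousOn_pi.2 fun k => ?_
  have hk := continuousOn_kalman hyi k
  exact (S.continuousOn_precisionDeriv k).prodMk ((continuousOn_kalmanRHS hy k hk).prodMk
    ((continuous_wnormSq _).comp_continuousOn (hy.sub (continuousOn_const.matrix_mulVec hk))))

theorem hasDerivWithinAt_params (hy : ContinuousOn y (Icc 0 S.T)) {t : ℝ} (ht : t ∈ Icc 0 S.T) :
    HasDerivWithinAt (S.params y) (S.paramsDeriv y t) (Icc 0 S.T) t := by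
  have hyi := integrableOn_of_memLp_two (hy.memLp_Ioo 2)
  refine hasDerivWithinAt_pi.2 fun k => ?_
  have hk := continuousOn_kalman hyi k
  have h1 : HasDerivWithinAt (S.kalman y k) (S.kalmanRHS y k (S.kalman y k) t) (Icc 0 S.T) t :=
    ((hasDerivWithinAt_integral_of_continuousOn (continuousOn_kalmanRHS hy k hk) ht).const_add
      S.x₀).congr (fun s hs => kalman_eq hyi k hs) (kalman_eq hyi k ht)
  have h2 : HasDerivWithinAt (S.residual y k)
      (wnormSq (S.Q k)⁻¹ (y t - S.C *ᵥ S.kalman y k t)) (Icc 0 S.T) t :=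
    hasDerivWithinAt_integral_of_continuousOn
      ((continuous_wnormSq _).comp_continuousOn (hy.sub (continuousOn_const.matrix_mulVec hk))) ht
  exact (S.hasDerivWithinAt_precision k ht).prodMk (h1.prodMk h2)

variable [Fintype ι]

theorem absolutelyContinuousOnInterval_params (hy : MemLp y 2 (volume.restrict (Ioo 0 S.T))) :
    AbsolutelyContinuousOnInterval (S.params y) 0 S.T := by
  refine AbsolutelyContinuousOnInterval.pi fun k => ?_
  refine AbsolutelyContinuousOnInterval.prodMk ?_ (AbsolutelyContinuousOnInterval.prodMk ?_ ?_)
  · exact absolutelyContinuousOnInterval_of_hasDerivWithinAt S.T_pos.le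
      (fun t ht => S.hasDerivWithinAt_precision k ht) (S.continuousOn_precisionDeriv k)
  · exact absolutelyContinuousOnInterval_kalman (integrableOn_of_memLp_two hy) k
  · exact (intervalIntegrable_residual hy k).absolutelyContinuousOnInterval_intervalIntegral
      (by simp)

theorem continuousOn_params (hy : MemLp y 2 (volume.restrict (Ioo 0 S.T))) :
    ContinuousOn (S.params y) (Icc 0 S.T) := by
  rw [← uIcc_of_le S.T_pos.le]
  exact (absolutelyContinuousOnInterval_params hy).continuousOn

theorem ae_hasDerivAt_params (hy : MemLp y 2 (volume.restrict (Ioo 0 S.T))) :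
    ∀ᵐ t, t ∈ Ioo 0 S.T → HasDerivAt (S.params y) (S.paramsDeriv y t) t := by
  have h1 := ae_all_iff.2 fun k => ae_hasDerivAt_kalman (integrableOn_of_memLp_two hy) k
  have h2 := ae_all_iff.2 fun k => (intervalIntegrable_residual hy k).ae_hasDerivAt_integral
  filter_upwards [h1, h2] with t ht1 ht2 hmem
  have hmem' := Ioo_subset_Icc_self hmem
  refine hasDerivAt_pi.2 fun k => ?_
  have hP : HasDerivAt (S.precision k) (S.precisionDeriv k t) t :=
    (S.hasDerivWithinAt_precision k hmem').hasDerivAt (Icc_mem_nhds hmem.1 hmem.2)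
  exact hP.prodMk ((ht1 k hmem).prodMk
    (ht2 k (by rwa [uIcc_of_le S.T_pos.le]) 0 (by simp)))

/-- Increments of the estimator are dominated by increments of the parameters. -/
theorem exists_dist_estimator_le [Nonempty ι] (hθ : 0 < θ)
    (hc : ContinuousOn (S.params y) (Icc 0 S.T)) :
    ∃ K ≥ 0, ∃ δ > 0, ∀ s ∈ Icc 0 S.T, ∀ t ∈ Icc 0 S.T, dist s t < δ →
      dist (S.estimator θ y s) (S.estimator θ y t) ≤ K * dist (S.params y s) (S.params y t) := by
  -- Compactness makes the local Lipschitz constants of `ψ` uniform. Only `s` is confined to the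
  -- piece `A`, so pairs straddling two pieces are covered once they are `δ`-close.
  refine isCompact_Icc.induction_on (s := Icc 0 S.T) (p := fun A => ∃ K ≥ (0 : ℝ), ∃ δ > 0,
    ∀ s ∈ A, ∀ t ∈ Icc 0 S.T, dist s t < δ →
      dist (S.estimator θ y s) (S.estimator θ y t) ≤ K * dist (S.params y s) (S.params y t))
    ⟨0, le_rfl, 1, one_pos, by simp⟩ ?_ ?_ ?_
  · rintro A B hAB ⟨K, hK, δ, hδ, h⟩
    exact ⟨K, hK, δ, hδ, fun s hs => h s (hAB hs)⟩
  · rintro A B ⟨K, hK, δ, hδ, h⟩ ⟨K', hK', δ', hδ', h'⟩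
    refine ⟨max K K', le_max_of_le_left hK, min δ δ', lt_min hδ hδ', ?_⟩
    rintro s (hs | hs) t ht hst
    · exact (h s hs t ht (hst.trans_le (min_le_left _ _))).trans (by gcongr; exact le_max_left _ _)
    · exact (h' s hs t ht (hst.trans_le (min_le_right _ _))).trans
        (by gcongr; exact le_max_right _ _)
  · intro x hx
    obtain ⟨ψ, -, ⟨K, U, hU, hL⟩, he⟩ := exists_local_estimator hθ hc hx
    obtain ⟨ε, hε, hball⟩ := Metric.mem_nhdsWithin_iff.1 (he.and ((hc x hx).eventually hU))
    -- With `s` within `ε/2` of `x`, every `t` within `ε/2` of `s` stays in the ball where `ψ`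
    -- represents the estimator.
    refine ⟨Metric.ball x (ε / 2) ∩ Icc 0 S.T,
      Filter.inter_mem (mem_nhdsWithin_of_mem_nhds (Metric.ball_mem_nhds x (half_pos hε)))
        self_mem_nhdsWithin, K, K.2, ε / 2, half_pos hε, fun s hs t ht hst => ?_⟩
    have hs' := hball ⟨Metric.ball_subset_ball (half_le_self hε.le) hs.1, hs.2⟩
    have ht' := hball ⟨show t ∈ Metric.ball x ε by
      have h1 := Metric.mem_ball.1 hs.1
      have h2 := dist_triangle_left t x s
      rw [Metric.mem_ball]
      linarith, ht⟩
    rw [hs'.1, ht'.1]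
    exact hL.dist_le_mul _ hs'.2 _ ht'.2

theorem absolutelyContinuousOnInterval_estimator [Nonempty ι] (hθ : 0 < θ)
    (hy : MemLp y 2 (volume.restrict (Ioo 0 S.T))) :
    AbsolutelyContinuousOnInterval (S.estimator θ y) 0 S.T := by
  obtain ⟨K, -, δ, hδ, h⟩ := exists_dist_estimator_le hθ (continuousOn_params hy)
  refine (absolutelyContinuousOnInterval_params hy).of_dist_le (K := K) hδ ?_
  rwa [uIcc_of_le S.T_pos.le]

theorem hasDerivAt_estimator [Nonempty ι] (hθ : 0 < θ)
    (hy : MemLp y 2 (volume.restrict (Ioo 0 S.T))) {t : ℝ} (ht : t ∈ Ioo 0 S.T)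
    (hd : HasDerivAt (S.params y) (S.paramsDeriv y t) t) :
    HasDerivAt (S.estimator θ y) (S.estimatorDeriv θ y t) t :=
  (hasDerivWithinAt_estimator hθ (continuousOn_params hy) (Ioo_subset_Icc_self ht)
    hd.hasDerivWithinAt).hasDerivAt (Icc_mem_nhds ht.1 ht.2)

theorem ae_hasDerivAt_estimator [Nonempty ι] (hθ : 0 < θ)
    (hy : MemLp y 2 (volume.restrict (Ioo 0 S.T))) :
    ∀ᵐ t, t ∈ Ioo 0 S.T → HasDerivAt (S.estimator θ y) (S.estimatorDeriv θ y t) t := by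
  filter_upwards [ae_hasDerivAt_params hy] with t ht hmem
  exact hasDerivAt_estimator hθ hy hmem (ht hmem)

/-- The explicit formula is not estimated. The bound on increments passes to derivatives, and the
derivative of `params` is in `L^p`. -/
theorem memLp_estimatorDeriv [Nonempty ι] (hθ : 0 < θ) {p : ℝ≥0∞} (hp : 1 ≤ p)
    (hy : MemLp y (2 * p) (volume.restrict (Ioo 0 S.T))) :
    MemLp (S.estimatorDeriv θ y) p (volume.restrict (Ioo 0 S.T)) := by
  have hy2 : MemLp y 2 (volume.restrict (Ioo 0 S.T)) :=
    hy.mono_exponent (le_mul_of_one_le_right zero_le hp)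
  have hyi := integrableOn_of_memLp_two hy2
  have := holderTriple_two_mul p
  have hbound : MemLp (fun t => ∑ k, (‖S.precisionDeriv k t‖ +
      (‖S.kalmanRHS y k (S.kalman y k) t‖ +
        ‖wnormSq (S.Q k)⁻¹ (y t - S.C *ᵥ S.kalman y k t)‖))) p (volume.restrict (Ioo 0 S.T)) := by
    refine memLp_finsetSum _ fun k _ => MemLp.add ?_ (MemLp.add ?_ ?_)
    · exact (S.continuousOn_precisionDeriv k).norm.memLp_Ioo p
    -- The filter equation is only affine in `y`, so this term is even in `L^{2p}`.
    · exact ((memLp_kalmanRHS hy hyi k).mono_exponent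
        (le_mul_of_one_le_left zero_le (by norm_num))).norm
    · exact ((memLp_innovation hy hyi k).wnormSq _).norm
  obtain ⟨K, hK, δ, hδ, h⟩ := exists_dist_estimator_le hθ (continuousOn_params hy2)
  refine hbound.of_le_mul (c := K) ?_ ?_
  -- Measurability is inherited from `deriv`, with which the formula agrees almost everywhere.
  · exact (aestronglyMeasurable_deriv (S.estimator θ y) _).congr
      (ae_deriv_eq_of_ae_hasDerivAt (ae_hasDerivAt_estimator hθ hy2))
  · rw [ae_restrict_iff' measurableSet_Ioo]
    filter_upwards [ae_hasDerivAt_params hy2] with t ht hmem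
    have hloc : ∀ᶠ s in nhds t, dist (S.estimator θ y s) (S.estimator θ y t) ≤
        K * dist (S.params y s) (S.params y t) := by
      filter_upwards [Icc_mem_nhds hmem.1 hmem.2, Metric.ball_mem_nhds t hδ] with s hs hs'
      exact h s hs t (Ioo_subset_Icc_self hmem) hs'
    refine ((hasDerivAt_estimator hθ hy2 hmem (ht hmem)).norm_le_of_dist_le (ht hmem) hloc).trans ?_
    gcongr
    refine le_trans ?_ (Real.le_norm_self _)
    refine (pi_norm_le_iff_of_nonneg (by positivity)).2 fun k => ?_
    refine le_trans ?_ (Finset.single_le_sum (f := fun k => ‖S.precisionDeriv k t‖ +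
      (‖S.kalmanRHS y k (S.kalman y k) t‖ +
        ‖wnormSq (S.Q k)⁻¹ (y t - S.C *ᵥ S.kalman y k t)‖)) (fun k _ => by positivity)
      (Finset.mem_univ k))
    refine (Prod.norm_def _).trans_le (max_le_add_of_nonneg (norm_nonneg _) (by positivity) |>.trans
      (add_le_add le_rfl ?_))
    exact (Prod.norm_def _).trans_le (max_le_add_of_nonneg (norm_nonneg _) (norm_nonneg _))

end UncertainSystem

/-! ### Continuity of the derivative and the `C¹` case. -/

namespace EntropicRisk

variable {Z ι : Type*} [TopologicalSpace Z] {n : ℕ} {θ : ℝ}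
  {q q' : Z → Params ι n} {x : Z → Fin n → ℝ}

theorem continuous_weight_comp (hq : Continuous q) (hx : Continuous x) (k : ι) :
    Continuous fun z => weight θ (q z) (x z) k := by
  have hqk : Continuous fun z => q z k := (continuous_apply k).comp hq
  have hd : Continuous fun z => x z - (q z k).2.1 := hx.sub hqk.snd.fst
  exact Real.continuous_exp.comp (continuous_const.mul
    ((hd.dotProduct (hqk.fst.matrix_mulVec hd)).add hqk.snd.snd))

variable [Fintype ι]

theorem continuous_hess_comp (hq : Continuous q) (hx : Continuous x) :
    Continuous fun z => hess θ (q z) (x z) := by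
  refine continuous_finsetSum _ fun k _ => ?_
  have hqk : Continuous fun z => q z k := (continuous_apply k).comp hq
  have hd : Continuous fun z => x z - (q z k).2.1 := hx.sub hqk.snd.fst
  exact (continuous_weight_comp hq hx k).smul (hqk.fst.add (((hqk.fst.matrix_mul
    (hd.matrix_vecMulVec hd)).matrix_mul hqk.fst).fun_const_smul _))

theorem continuous_gradParam_comp (hq : Continuous q) (hq' : Continuous q') (hx : Continuous x) :
    Continuous fun z => gradParam θ (q z) (q' z) (x z) := by
  have hqk : ∀ k, Continuous fun z => q z k := fun k => (continuous_apply k).comp hq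
  have hqk' : ∀ k, Continuous fun z => q' z k := fun k => (continuous_apply k).comp hq'
  have hd : ∀ k, Continuous fun z => x z - (q z k).2.1 := fun k => hx.sub (hqk k).snd.fst
  have hPξ : ∀ k, Continuous fun z => (q z k).1 *ᵥ (q' z k).2.1 := fun k =>
    (hqk k).fst.matrix_mulVec (hqk' k).snd.fst
  have hPd : ∀ k, Continuous fun z => (q' z k).1 *ᵥ (x z - (q z k).2.1) := fun k =>
    (hqk' k).fst.matrix_mulVec (hd k)
  refine Continuous.add (continuous_finsetSum _ fun k _ => ?_).neg
    ((continuous_finsetSum _ fun k _ => ?_).const_smul θ)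
  · exact (continuous_weight_comp hq hx k).smul ((hPξ k).sub (hPd k))
  · exact ((continuous_weight_comp hq hx k).mul (((hqk' k).snd.snd.sub
      (continuous_const.mul ((hd k).dotProduct (hPξ k)))).add ((hd k).dotProduct (hPd k)))).smul
      ((hqk k).fst.matrix_mulVec (hd k))

end EntropicRisk

namespace UncertainSystem

open EntropicRisk
open scoped Matrix.Norms.Operator

variable {ι : Type*} {n m r : ℕ} {S : UncertainSystem ι n m r} {y : ℝ → Fin r → ℝ} {θ : ℝ}
variable [Fintype ι] [Nonempty ι]

theorem hasDerivWithinAt_estimator_of_continuousOn (hθ : 0 < θ) (hy : ContinuousOn y (Icc 0 S.T))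
    {t : ℝ} (ht : t ∈ Icc 0 S.T) :
    HasDerivWithinAt (S.estimator θ y) (S.estimatorDeriv θ y t) (Icc 0 S.T) t :=
  hasDerivWithinAt_estimator hθ (continuousOn_params (hy.memLp_Ioo 2)) ht
    (hasDerivWithinAt_params hy ht)

theorem continuousOn_vecV_estimator (hθ : 0 < θ) (hy : ContinuousOn y (Icc 0 S.T)) :
    ContinuousOn (fun t => S.vecV θ y t (S.estimator θ y t)) (Icc 0 S.T) := by
  have hq := continuousOn_params (S := S) (hy.memLp_Ioo 2)
  have h : ContinuousOn (fun t => gradParam θ (S.params y t) (S.paramsDeriv y t)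
      (S.estimator θ y t)) (Icc 0 S.T) :=
    -- Taking `Z` to be the subtype `Icc 0 S.T` turns continuity on the interval into plain
    -- continuity.
    continuousOn_iff_continuous_domRestrict.2 (continuous_gradParam_comp
      (continuousOn_iff_continuous_domRestrict.1 hq)
      (continuousOn_iff_continuous_domRestrict.1 (continuousOn_paramsDeriv hy))
      (continuousOn_iff_continuous_domRestrict.1 (continuousOn_estimator hθ hq)))
  exact h.congr fun t ht => vecV_eq_gradParam ht (hasDerivWithinAt_params hy ht) _

theorem continuousOn_matM_estimator (hθ : 0 < θ) (hy : ContinuousOn y (Icc 0 S.T)) :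
    ContinuousOn (fun t => S.matM θ y t (S.estimator θ y t)) (Icc 0 S.T) := by
  have hq := continuousOn_params (S := S) (hy.memLp_Ioo 2)
  simp only [matM_eq_hess]
  exact continuousOn_iff_continuous_domRestrict.2 (continuous_hess_comp
    (continuousOn_iff_continuous_domRestrict.1 hq)
    (continuousOn_iff_continuous_domRestrict.1 (continuousOn_estimator hθ hq)))

theorem continuousOn_estimatorDeriv (hθ : 0 < θ) (hy : ContinuousOn y (Icc 0 S.T)) :
    ContinuousOn (S.estimatorDeriv θ y) (Icc 0 S.T) :=
  (((continuousOn_matM_estimator hθ hy).matrix_inv fun _ ht =>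
    isUnit_matM hθ ht _).matrix_mulVec (continuousOn_vecV_estimator hθ hy)).neg

theorem contDiffOn_estimator (hθ : 0 < θ) (hy : ContinuousOn y (Icc 0 S.T)) :
    ContDiffOn ℝ 1 (S.estimator θ y) (Icc 0 S.T) := by
  have hu := uniqueDiffOn_Icc S.T_pos
  rw [contDiffOn_one_iff_derivWithin hu]
  refine ⟨fun t ht => (hasDerivWithinAt_estimator_of_continuousOn hθ hy ht).differentiableWithinAt,
    (continuousOn_estimatorDeriv hθ hy).congr fun t ht => ?_⟩
  exact (hasDerivWithinAt_estimator_of_continuousOn hθ hy ht).derivWithin (hu t ht)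

end UncertainSystem

theorem theorem3p8 {ι : Type*} [Fintype ι] [Nonempty ι] {n m r : ℕ}
    (S : UncertainSystem ι n m r) (θ : ℝ) (hθ : 0 < θ) :
    (∀ (p : ℕ) (_ : 1 ≤ p) (y : ℝ → Fin r → ℝ),
      MemLp y (2 * (p : ℝ≥0∞)) (volume.restrict (Ioo 0 S.T)) →
        MemW1p S.T (p : ℝ≥0∞) (S.estimator θ y) ∧
        (∀ t ∈ Icc 0 S.T, IsUnit (S.matM θ y t (S.estimator θ y t))) ∧
        HasWeakDeriv S.T (S.estimator θ y) (S.estimatorDeriv θ y)) ∧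
    (∀ y : ℝ → Fin r → ℝ, ContinuousOn y (Icc 0 S.T) →
        ContDiffOn ℝ 1 (S.estimator θ y) (Icc 0 S.T) ∧
        (∀ t ∈ Icc 0 S.T, IsUnit (S.matM θ y t (S.estimator θ y t))) ∧
        ∀ t ∈ Icc 0 S.T,
          HasDerivWithinAt (S.estimator θ y) (S.estimatorDeriv θ y t) (Icc 0 S.T) t) := by
  refine ⟨fun p hp y hy => ?_, fun y hy => ⟨UncertainSystem.contDiffOn_estimator hθ hy,
    fun t ht => UncertainSystem.isUnit_matM hθ ht _,
    fun t ht => UncertainSystem.hasDerivWithinAt_estimator_of_continuousOn hθ hy ht⟩⟩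
  have hp' : (1 : ℝ≥0∞) ≤ p := by exact_mod_cast hp
  -- On a bounded interval `L^{2p} ⊆ L²` for `p ≥ 1`, and `L²` suffices for absolute continuity.
  have hy2 : MemLp y 2 (volume.restrict (Ioo 0 S.T)) :=
    hy.mono_exponent (le_mul_of_one_le_right zero_le hp')
  have hweak : HasWeakDeriv S.T (S.estimator θ y) (S.estimatorDeriv θ y) :=
    (UncertainSystem.absolutelyContinuousOnInterval_estimator hθ hy2).hasWeakDeriv S.T_pos
      (UncertainSystem.ae_hasDerivAt_estimator hθ hy2)
  exact ⟨⟨(UncertainSystem.continuousOn_estimator hθ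
      (UncertainSystem.continuousOn_params hy2)).memLp_Ioo _,
    _, UncertainSystem.memLp_estimatorDeriv hθ hp' hy, hweak⟩,
    fun t ht => UncertainSystem.isUnit_matM hθ ht _, hweak⟩
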